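/- Let $0<\alpha<\pi/2$ and $S_\alpha=\{z\in\mathbb C:\operatorname{Re}z>0,\ |\arg z|<\alpha\}$. Let $H(S_\alpha)$ be the space of holomorphic functions on $S_\alpha$ with the topology of locally uniform convergence, and let $\phi$ be a continuous linear functional on $H(S_\alpha)$ induced by a complex Borel measure $\mu$ with compact support in $S_\alpha$, that is, $\langle g,\phi\rangle=\int_{S_\alpha}g\,d\mu$ for all $g\in H(S_\alpha)$. Assume that $\mu$ is symmetric, $\mu(\overline E)=\overline{\mu(E)}$ for all Borel sets $E\subset S_\alpha$, and that $\int_{S_\alpha}d\mu=0$. Let $f(z)=\langle e_{-z},\phi\rangle$, where $e_{-z}(\xi)=e^{-z\xi}$, be the Fourier–Borel transform of $\phi$, and suppose that $f(x)\in\mathbb R$ for all $x>0$. For an analytic semigroup $T=(T(t))_{t\in S_\alpha}$ in a complex Banach algebra $B$ (with or without unit), i.e. a norm-holomorphic map $T:S_\alpha\to B$ with $T(s+t)=T(s)T(t)$, formally $T(t)=\exp(tA)$, put $f(-tA)=\int_{S_\alpha}T(t\xi)\,d\mu(\xi)$ for $t>0$. Let $\rho$ denote the spectral radius, let $\mathcal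 A$ be the closed subalgebra of $B$ generated by $\{T(t):t\in S_\alpha\}$ (not necessarily unital), let $\operatorname{rad}\mathcal A$ be its radical, i.e. the set of elements of $\mathcal A$ with spectral radius $0$, and let $\pi:\mathcal A\to\mathcal A/\operatorname{rad}\mathcal A$ be the canonical surjection. Call $T$ quasinilpotent if $\rho(T(t))=0$ for all $t\in S_\alpha$. (1) Let $T$ be a non-quasinilpotent analytic semigroup on $S_\alpha$ in a complex Banach algebra. If there is $t_0>0$ such that $$\rho(f(-tA))<\sup_{x>0}|f(x)|\qquad\text{for all }0<t\le t_0,$$ then $\mathcal A/\operatorname{rad}\mathcal A$ is unital, with unit $e$ say, and the semigroup $(\pi(T(t)))_{t\in S_\alpha}$ has a bounded generator: there is $u\in\mathcal A/\operatorname{rad}\mathcal A$ with $\pi(T(t))=e+\sum_{k\ge1}(tu)^k/k!$ for all $t\in S_\alpha$. (2) This is sharp: let $T(t):x\mapsto x^t$ in the Banach algebra $C_0([0,1])$ of continuous complex functions on $[0,1]$ vanishing at $0$. Then $(T(t))_{t\in S_\alpha}$ is a non-quasinilpotent analytic semigroup with $$\rho(f(-tA))=\sup_{x>0}|f(x)|\qquad\text{for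 all }t>0,$$ but $\mathcal A/\operatorname{rad}\mathcal A$ is not unital, and $T(t)$ has no norm limit as $t\to0^+$. -/

import Mathlib

open MeasureTheory Set Filter Topology
open scoped ENNReal

noncomputable section

namespace SectorSemigroup

/-! ### Sectors, holomorphic functions on them, and analytic functionals -/

/-- The open sector `S_α = {z : Re z > 0, |arg z| < α}`. -/
def sector (α : ℝ) : Set ℂ := {z | 0 < z.re ∧ |z.arg| < α}

/-- The space `H(S_α)` of holomorphic functions on the sector.  Its topology is induced by the
compact-open topology of `C(S_α, ℂ)`: it is the topology of locally uniform convergence. -/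
def holSpace (α : ℝ) : Submodule ℂ C(sector α, ℂ) where
  carrier := {g | ∃ G : ℂ → ℂ, DifferentiableOn ℂ G (sector α) ∧ ∀ z : sector α, g z = G z}
  add_mem' := by
    rintro g h ⟨G, hG, hg⟩ ⟨H, hH, hh⟩
    exact ⟨G + H, hG.add hH, fun z => by simp [hg, hh]⟩
  zero_mem' := ⟨0, differentiableOn_const 0, fun z => by simp⟩
  smul_mem' := by
    rintro c g ⟨G, hG, hg⟩
    exact ⟨c • G, hG.const_smul c, fun z => by simp [hg]⟩

/-- The function `e_{-z} : ξ ↦ exp (-z ξ)` as an element of `H(S_α)`. -/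
def expNeg (α : ℝ) (z : ℂ) : holSpace α :=
  ⟨⟨fun ξ => Complex.exp (-z * ξ), by fun_prop⟩,
    fun ξ => Complex.exp (-z * ξ), by fun_prop, fun _ => rfl⟩

/-- The Fourier--Borel transform `z ↦ ⟨e_{-z}, φ⟩` of a continuous linear functional on
`H(S_α)`. -/
def fourierBorel {α : ℝ} (φ : holSpace α →L[ℂ] ℂ) (z : ℂ) : ℂ := φ (expNeg α z)

/-! ### Complex measures on the sector -/

/-- The integral `∫ g dμ` of a vector-valued function against a complex measure. -/
def cintegral {X E : Type*} [MeasurableSpace X] [NormedAddCommGroup E] [NormedSpace ℂ E]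
    (μ : ComplexMeasure X) (g : X → E) : E :=
  VectorMeasure.integral μ g (ContinuousLinearMap.lsmul ℝ ℂ).flip

/-- The measure `μ` belongs to `M_c(S_α)`: it vanishes off a compact subset of the open sector. -/
def HasCompactSupp {α : ℝ} (μ : ComplexMeasure (sector α)) : Prop :=
  ∃ K : Set (sector α), IsCompact K ∧ ∀ E, MeasurableSet E → Disjoint E K → μ E = 0

theorem conj_mem_sector {α : ℝ} {z : ℂ} (hz : z ∈ sector α) :
    starRingEnd ℂ z ∈ sector α := by
  refine ⟨by simpa using hz.1, ?_⟩
  rw [Complex.arg_conj]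
  split_ifs with h
  · exact h ▸ hz.2
  · simpa using hz.2

/-- Complex conjugation as a map of the sector to itself. -/
def sectorConj {α : ℝ} (z : sector α) : sector α := ⟨starRingEnd ℂ z, conj_mem_sector z.2⟩

/-- `μ` is symmetric: the measure of the complex conjugate of `E` is the conjugate of `μ E`. -/
def IsSymmetric {α : ℝ} (μ : ComplexMeasure (sector α)) : Prop :=
  ∀ E, MeasurableSet E → μ (sectorConj '' E) = starRingEnd ℂ (μ E)

/-- The functional `φ` on `H(S_α)` is induced by the measure `μ`. -/
def IsInducedBy {α : ℝ} (φ : holSpace α →L[ℂ] ℂ) (μ : ComplexMeasure (sector α)) : Prop :=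
  ∀ g : holSpace α, φ g = cintegral μ (fun ξ => (g : C(sector α, ℂ)) ξ)

/-! ### Banach algebras, possibly without unit -/

section Algebra

/-- The spectral radius of an element of a complex algebra, with or without unit.  (For an algebra
without unit the quasispectrum is the spectrum in the unitization; for a unital one it is the
spectrum together with `0`.) -/
def specRadius {A : Type*} [NonUnitalRing A] [Module ℂ A] (a : A) : ℝ≥0∞ :=
  ⨆ z ∈ quasispectrum ℂ a, ‖z‖ₑ

variable (A : Type*) [NonUnitalRing A] [Module ℂ A] [IsScalarTower ℂ A A] [SMulCommClass ℂ A A]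

/-- The (Jacobson) radical of a complex algebra `A`, with or without unit: the intersection of `A`
with the Jacobson radical of its unitization.  For commutative Banach algebras it is the set of
elements of spectral radius zero, see `mem_radical_iff`. -/
def radical : Submodule ℂ A where
  carrier := {a | (a : Unitization ℂ A) ∈ Ring.jacobson (Unitization ℂ A)}
  add_mem' := by
    intro a b ha hb
    simpa [Unitization.inr_add] using add_mem ha hb
  zero_mem' := by simp
  smul_mem' := by
    intro c a ha
    have := (Ring.jacobson (Unitization ℂ A)).mul_mem_left (algebraMap ℂ _ c) ha
    simpa [Unitization.inr_smul, Algebra.smul_def] using this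

/-- The quotient algebra `A / rad A`. -/
abbrev ModRad := A ⧸ radical A

variable {A}

theorem radical_mul_mem_left (a : A) {b : A} (hb : b ∈ radical A) : a * b ∈ radical A := by
  have := (Ring.jacobson (Unitization ℂ A)).mul_mem_left (a : Unitization ℂ A) hb
  rw [← Unitization.inr_mul] at this
  exact this

theorem radical_mul_mem_right {a : A} (b : A) (ha : a ∈ radical A) : a * b ∈ radical A := by
  have := (Ring.jacobson (Unitization ℂ A)).mul_mem_right (b : Unitization ℂ A) ha
  rw [← Unitization.inr_mul] at this
  exact this

variable (A)

/-- The canonical surjection `π : A → A / rad A`. -/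
def toModRad : A →ₗ[ℂ] ModRad A := (radical A).mkQ

instance : Mul (ModRad A) where
  mul := Quotient.map₂ (· * ·) (by
    intro a a' h b b' h'
    have h1 : a - a' ∈ radical A := (Submodule.quotientRel_def _).1 h
    have h2 : b - b' ∈ radical A := (Submodule.quotientRel_def _).1 h'
    refine (Submodule.quotientRel_def _).2 ?_
    have : a * b - a' * b' = (a - a') * b + a' * (b - b') := by
      rw [sub_mul, mul_sub]; abel
    rw [this]
    exact add_mem (radical_mul_mem_right b h1) (radical_mul_mem_left a' h2))

theorem toModRad_mul (a b : A) : toModRad A (a * b) = toModRad A a * toModRad A b := rfl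

instance : NonUnitalRing (ModRad A) where
  left_distrib := by
    rintro ⟨a⟩ ⟨b⟩ ⟨c⟩
    exact congrArg (toModRad A) (mul_add a b c)
  right_distrib := by
    rintro ⟨a⟩ ⟨b⟩ ⟨c⟩
    exact congrArg (toModRad A) (add_mul a b c)
  zero_mul := by
    rintro ⟨a⟩
    exact congrArg (toModRad A) (zero_mul a)
  mul_zero := by
    rintro ⟨a⟩
    exact congrArg (toModRad A) (mul_zero a)
  mul_assoc := by
    rintro ⟨a⟩ ⟨b⟩ ⟨c⟩
    exact congrArg (toModRad A) (mul_assoc a b c)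

end Algebra

theorem mem_jacobson_iff {U : Type*} [NormedCommRing U] [NormedAlgebra ℂ U] [CompleteSpace U]
    (x : U) : x ∈ Ring.jacobson U ↔ spectrum ℂ x ⊆ {0} := by
  rw [Ring.jacobson_eq_sInf_isMaximal, Ideal.mem_sInf]
  constructor
  · intro h z hz
    obtain ⟨f, rfl⟩ := WeakDual.CharacterSpace.mem_spectrum_iff_exists.1 hz
    have hf : Function.Surjective (f : U →+* ℂ) := fun c =>
      ⟨algebraMap ℂ U c, by simpa using AlgHomClass.commutes f c⟩
    exact h (I := RingHom.ker (f : U →+* ℂ)) (RingHom.ker_isMaximal_of_surjective _ hf)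
  · intro h M hM
    have : M.IsMaximal := hM
    by_contra hx
    obtain ⟨y, m, hm, hy⟩ := hM.exists_inv hx
    have h1 := congrArg M.toCharacterSpace hy
    have h2 : M.toCharacterSpace x = 0 :=
      h (WeakDual.CharacterSpace.mem_spectrum_iff_exists.2 ⟨_, rfl⟩)
    rw [map_add, map_mul, h2, M.toCharacterSpace_apply_eq_zero_of_mem hm] at h1
    simp at h1

/-- In a commutative complex Banach algebra the radical is the set of elements with spectral
radius zero. -/
theorem mem_radical_iff {A : Type*} [NonUnitalNormedCommRing A] [NormedSpace ℂ A]
    [IsScalarTower ℂ A A] [SMulCommClass ℂ A A] [CompleteSpace A] (a : A) :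
    a ∈ radical A ↔ specRadius a = 0 := by
  have h0 : specRadius a = 0 ↔ spectrum ℂ (a : Unitization ℂ A) ⊆ {0} := by
    simp [specRadius, Unitization.quasispectrum_eq_spectrum_inr, Set.subset_def]
  have h1 : a ∈ radical A ↔ (a : Unitization ℂ A) ∈ Ring.jacobson (Unitization ℂ A) := Iff.rfl
  let U := WithLp 1 (Unitization ℂ A)
  let : NormedCommRing U :=
    { WithLp.instUnitizationNormedRing with
      mul_comm := fun x y => WithLp.ofLp_injective 1 (mul_comm _ _) }
  let : NormedAlgebra ℂ U :=
    { (WithLp.instUnitizationNormedAlgebra : NormedAlgebra ℂ (WithLp 1 (Unitization ℂ A))) with }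
  let e : Unitization ℂ A ≃ₐ[ℂ] U := (WithLp.unitizationAlgEquiv (𝕜 := ℂ) (A := A) ℂ).symm
  have hU := mem_jacobson_iff (U := U) (e a)
  rw [AlgEquiv.spectrum_eq e] at hU
  rw [h0, h1, ← hU]
  constructor
  · intro h
    have : RingHomSurjective (e : Unitization ℂ A →+* U) := ⟨e.surjective⟩
    exact Ring.le_comap_jacobson (e : Unitization ℂ A →+* U) h
  · intro h
    have : RingHomSurjective (e.symm : U →+* Unitization ℂ A) := ⟨e.symm.surjective⟩
    have := Ring.le_comap_jacobson (e.symm : U →+* Unitization ℂ A) h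
    simpa using this

/-- `e` is a two-sided identity element. -/
def IsIdentity {R : Type*} [Mul R] (e : R) : Prop := ∀ x, e * x = x ∧ x * e = x

/-- Powers `u ^ k` in an algebra with identity element `e` (so that `u ^ 0 = e`). -/
def powWith {R : Type*} [Mul R] (e u : R) : ℕ → R
  | 0 => e
  | k + 1 => powWith e u k * u

/-! ### Analytic semigroups -/

section Semigroup

variable {B : Type*} [NonUnitalNormedRing B] [NormedSpace ℂ B] [IsScalarTower ℂ B B]
  [SMulCommClass ℂ B B]

/-- `(T(t))_{t ∈ S_α}` is an analytic semigroup in the Banach algebra `B` (the values of `T` off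
the sector are irrelevant). -/
structure IsAnalyticSemigroup (α : ℝ) (T : ℂ → B) : Prop where
  differentiableOn : DifferentiableOn ℂ T (sector α)
  map_add : ∀ s ∈ sector α, ∀ t ∈ sector α, T (s + t) = T s * T t

/-- All elements of the semigroup have spectral radius zero. -/
def IsQuasinilpotent (α : ℝ) (T : ℂ → B) : Prop := ∀ t ∈ sector α, specRadius (T t) = 0

/-- The closed subalgebra of `B` generated by `(T(t))_{t ∈ S_α}`; it need not contain a unit. -/
def semigroupAlgebra (α : ℝ) (T : ℂ → B) : NonUnitalSubalgebra ℂ B :=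
  (NonUnitalAlgebra.adjoin ℂ (T '' sector α)).topologicalClosure

theorem mem_semigroupAlgebra {α : ℝ} (T : ℂ → B) {t : ℂ} (ht : t ∈ sector α) :
    T t ∈ semigroupAlgebra α T :=
  NonUnitalSubalgebra.le_topologicalClosure _
    (NonUnitalAlgebra.subset_adjoin ℂ (Set.mem_image_of_mem T ht))

/-- The class `π(T(t))` in the quotient of the generated algebra by its radical. -/
def classOf {α : ℝ} (T : ℂ → B) (t : sector α) : ModRad (semigroupAlgebra α T) :=
  toModRad _ ⟨T t, mem_semigroupAlgebra T t.2⟩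

/-- For an analytic semigroup `T(t) = exp(tA)` and the Fourier--Borel transform `f` of (the
functional induced by) `μ`, the element `f(-tA) = ∫ T(tξ) dμ(ξ)`, for `t > 0`. -/
def funcCalc {α : ℝ} (μ : ComplexMeasure (sector α)) (T : ℂ → B) (t : ℝ) : B :=
  cintegral μ (fun ξ => T (t * ξ))

/-- The identity `e` and the element `u` exhibit a bounded generator of `(π(T(t)))_{t ∈ S_α}`:
`π(T(t)) = exp(tu) = e + ∑_{k ≥ 1} (tu)^k / k!` for all `t ∈ S_α`, with convergence in the quotient
norm. -/
def IsBoundedGenerator {α : ℝ} (T : ℂ → B) (e u : ModRad (semigroupAlgebra α T)) : Prop :=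
  ∀ t : sector α,
    HasSum (fun k : ℕ => ((t : ℂ) ^ k / (k.factorial : ℂ)) • powWith e u k) (classOf T t)

end Semigroup

/-- The supremum of `|f(x)|` over `x > 0`. -/
def supOnPos (f : ℂ → ℂ) : ℝ≥0∞ := ⨆ x : ℝ, ⨆ _ : 0 < x, ‖f x‖ₑ

/-- The semigroup `T(t) : x ↦ x ^ t`, for `Re t > 0`, in the Banach algebra `C₀([0,1])` of
continuous functions on `[0,1]` that vanish at `0`. -/
def powSemigroup (t : ℂ) : ContinuousMapZero unitInterval ℂ :=
  if ht : 0 < t.re then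
    { toFun := fun x => ((x : ℝ) : ℂ) ^ t
      continuous_toFun := continuous_iff_continuousAt.2 fun x =>
        (Complex.continuousAt_ofReal_cpow_const (x : ℝ) t (Or.inl ht)).comp
          continuous_subtype_val.continuousAt
      map_zero' := by
        have : t ≠ 0 := by rintro rfl; simp at ht
        simp [Complex.zero_cpow this] }
  else 0

end SectorSemigroup

end

/-! The closed algebra `A` generated by `T` is commutative, so it can be studied through the
characters `χ` of its unitization. On the semigroup, `χ` is either identically zero or of the form
`χ(T(t)) = exp(tc)`, and in the second case `χ(f(-tA)) = f(-tc)`. The core of the proof is that the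
exponents `c` form a bounded set (`bounded_of_enorm_laplace_lt`).

Bounding `T` on a compact neighbourhood of the support of `μ` gives `Re(ξc) + η|c| ≤ M` for all `ξ`
in the support (`exists_re_mul_add_le`). So if `|c|` is large, `f` decays exponentially on the cone
spanned by `z = -c` and its conjugate. On the ray through `z`, the hypothesis gives `|f| < sup` for
`t ≤ t₀` and the decay gives it for `t > t₀`. As `f` is real on the positive axis, `f` commutes with
conjugation, so the conjugate ray obeys the same bound. At the vertex, `f(0) = μ(S_α) = 0`. The
maximum principle in the cone (`exists_lt_bound_on_pos`) then bounds `|f|` on the positive axis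
strictly below its own supremum, which is absurd.

Once the exponents are bounded, a small `r > 0` makes each `χ(T(r))` equal to `0` or close to `1`.
Splitting the spectrum (`exists_isIdempotentElem_mul`) gives an idempotent `p` in the ideal of
`T(r)`, with `χ(p) = 1` unless `χ` kills the semigroup. Elements on which all characters vanish are
radical, so `π(p)` is the unit. The semigroup `T(t)p + 1 - p` is invertible, hence of the form
`exp(tu)` (`exists_idempotent_exp`).

For the powers `x ^ t`, evaluation at `x > 0` turns `f(-tA)` into `f(-t log x)`, and `-t log x` runs
over `[0, ∞)`. A unit, or a limit at `0⁺`, would be a continuous function equal to `1` on `(0,1]`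
and to `0` at `0`. -/

namespace SectorSemigroup

/-! ### Integration against complex measures -/

section Integration

/-- The total variations of the real and imaginary parts are finite, and their sum dominates the
variation. -/
theorem isFiniteMeasure_variation {X : Type*} [MeasurableSpace X] (μ : ComplexMeasure X) :
    IsFiniteMeasure μ.variation := by
  refine isFiniteMeasure_of_le ((ComplexMeasure.re μ).totalVariation +
    (ComplexMeasure.im μ).totalVariation) ?_
  refine VectorMeasure.variation_le_of_forall_enorm_le fun E _ => ?_
  have h : μ E = ((ComplexMeasure.re μ E : ℝ) : ℂ) + (ComplexMeasure.im μ E : ℝ) * Complex.I :=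
    (Complex.re_add_im (μ E)).symm
  calc ‖μ E‖ₑ ≤ ‖((ComplexMeasure.re μ E : ℝ) : ℂ)‖ₑ
        + ‖((ComplexMeasure.im μ E : ℝ) : ℂ) * Complex.I‖ₑ := by
          conv_lhs => rw [h]
          exact enorm_add_le _ _
    _ = ‖ComplexMeasure.re μ E‖ₑ + ‖ComplexMeasure.im μ E‖ₑ := by
          simp [← ofReal_norm]
    _ ≤ _ := add_le_add (SignedMeasure.enorm_le_totalVariation _ _)
          (SignedMeasure.enorm_le_totalVariation _ _)

variable {E F : Type*} [NormedAddCommGroup E] [NormedSpace ℂ E]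
  [NormedAddCommGroup F] [NormedSpace ℂ F]

theorem norm_lsmul_flip_le : ‖(ContinuousLinearMap.lsmul ℝ ℂ (E := E)).flip‖ ≤ 1 := by
  rw [ContinuousLinearMap.opNorm_flip]
  exact ContinuousLinearMap.opNorm_lsmul_le

variable {X : Type*} [MeasurableSpace X] {μ : ComplexMeasure X} {K : Set X}

theorem cintegral_sub {g h : X → E}
    (hg : Integrable g μ.variation) (hh : Integrable h μ.variation) :
    cintegral μ (fun x => g x - h x) = cintegral μ g - cintegral μ h :=
  VectorMeasure.integral_fun_sub hg hh

theorem cintegral_one : cintegral μ (fun _ => (1 : ℂ)) = μ univ := by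
  have := isFiniteMeasure_variation μ
  exact (VectorMeasure.integral_const _).trans (by simp)

theorem map_cintegral [CompleteSpace E] [CompleteSpace F] (L : E →L[ℂ] F) {g : X → E}
    (hg : Integrable g μ.variation) : L (cintegral μ g) = cintegral μ fun x => L (g x) := by
  have h1 := VectorMeasure.continuousLinearMap_apply_integral
    (B := (ContinuousLinearMap.lsmul ℝ ℂ (E := E)).flip) (C := L.restrictScalars ℝ) hg
  have h2 := VectorMeasure.integral_continuousLinearMap_comp
    (B := (ContinuousLinearMap.lsmul ℝ ℂ (E := F)).flip) (C := L.restrictScalars ℝ) hg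
  refine h1.trans (Eq.trans ?_ h2.symm)
  congr 1
  ext x c
  simp

theorem cintegral_const_smul [CompleteSpace E] (c : ℂ) {g : X → E}
    (hg : Integrable g μ.variation) :
    cintegral μ (fun x => c • g x) = c • cintegral μ g :=
  (map_cintegral (c • ContinuousLinearMap.id ℂ E) hg).symm

variable [TopologicalSpace X] [T2Space X] [BorelSpace X]

theorem ae_mem_of_compact_support (hK : IsCompact K)
    (hμ : ∀ E, MeasurableSet E → Disjoint E K → μ E = 0) : ∀ᵐ x ∂μ.variation, x ∈ K := by
  have hm : MeasurableSet Kᶜ := hK.isClosed.measurableSet.compl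
  refine (VectorMeasure.variation_apply_eq_zero hm).2 fun t ht htm => hμ t htm ?_
  exact Set.disjoint_left.2 fun x hx hxK => ht hx hxK

theorem norm_cintegral_le (hK : IsCompact K)
    (hμ : ∀ E, MeasurableSet E → Disjoint E K → μ E = 0) {g : X → E} {C : ℝ} (hC₀ : 0 ≤ C)
    (hC : ∀ x ∈ K, ‖g x‖ ≤ C) : ‖cintegral μ g‖ ≤ C * μ.variation.real univ := by
  have := isFiniteMeasure_variation μ
  refine (VectorMeasure.norm_integral_le_of_norm_le_const
    ((ae_mem_of_compact_support hK hμ).mono hC)).trans ?_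
  refine mul_le_mul_of_nonneg_right ?_ measureReal_nonneg
  exact mul_le_of_le_one_right hC₀ norm_lsmul_flip_le

variable [SecondCountableTopology X]

theorem integrable_of_compact_support {E : Type*} [NormedAddCommGroup E] (hK : IsCompact K)
    (hμ : ∀ E, MeasurableSet E → Disjoint E K → μ E = 0) {g : X → E} (hg : Continuous g) :
    Integrable g μ.variation := by
  have := isFiniteMeasure_variation μ
  obtain ⟨C, hC⟩ := hK.exists_bound_of_continuousOn hg.continuousOn
  exact Integrable.of_bound hg.aestronglyMeasurable C
    ((ae_mem_of_compact_support hK hμ).mono hC)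

end Integration

/-- A quadratic remainder is `o(w)`. This serves both for differentiation under the integral and for
the semigroup of powers. -/
theorem hasDerivAt_of_norm_sub_le_sq {E : Type*} [NormedAddCommGroup E] [NormedSpace ℂ E]
    {F : ℂ → E} {D : E} {z : ℂ} {C δ : ℝ} (hδ : 0 < δ)
    (h : ∀ w : ℂ, ‖w‖ < δ → ‖F (z + w) - F z - w • D‖ ≤ C * ‖w‖ ^ 2) : HasDerivAt F D z := by
  rw [hasDerivAt_iff_isLittleO_nhds_zero]
  have h1 : (fun w : ℂ => F (z + w) - F z - w • D) =O[𝓝 0] fun w : ℂ => w ^ 2 := by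
    refine Asymptotics.IsBigO.of_bound C ?_
    filter_upwards [Metric.ball_mem_nhds (0 : ℂ) hδ] with w hw
    simpa using h w (by simpa using hw)
  refine h1.trans_isLittleO ?_
  have := Asymptotics.isLittleO_pow_pow (𝕜 := ℂ) one_lt_two
  simpa using this

/-! ### The Laplace transform of a compactly supported measure on the sector -/

section Laplace

variable {α : ℝ} {μ : ComplexMeasure (sector α)} {K : Set (sector α)}

/-- The function `z ↦ ∫ exp (-z ξ) dμ(ξ)`. -/
noncomputable def laplace (μ : ComplexMeasure (sector α)) (z : ℂ) : ℂ :=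
  cintegral μ fun ξ => Complex.exp (-z * ξ)

theorem fourierBorel_eq_laplace {φ : holSpace α →L[ℂ] ℂ} (h : IsInducedBy φ μ) :
    fourierBorel φ = laplace μ := funext fun z => h (expNeg α z)

theorem laplace_zero (hμ : μ univ = 0) : laplace μ 0 = 0 := by
  simp [laplace, cintegral_one, hμ]

theorem norm_laplace_le (hK : IsCompact K)
    (hμ : ∀ E, MeasurableSet E → Disjoint E K → μ E = 0) {z : ℂ} {m : ℝ}
    (hm : ∀ ξ ∈ K, m ≤ (z * ξ).re) :
    ‖laplace μ z‖ ≤ Real.exp (-m) * μ.variation.real univ := by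
  refine norm_cintegral_le hK hμ (Real.exp_pos _).le fun ξ hξ => ?_
  rw [Complex.norm_exp, Real.exp_le_exp, neg_mul, Complex.neg_re]
  exact neg_le_neg (hm ξ hξ)

theorem differentiable_laplace (hK : IsCompact K)
    (hμ : ∀ E, MeasurableSet E → Disjoint E K → μ E = 0) : Differentiable ℂ (laplace μ) := by
  intro z
  obtain ⟨R, hR⟩ := hK.exists_bound_of_continuousOn (f := fun ξ : sector α => (ξ : ℂ))
    continuous_subtype_val.continuousOn
  obtain ⟨C, hC⟩ := hK.exists_bound_of_continuousOn
    (f := fun ξ : sector α => Complex.exp (-z * ξ)) (by fun_prop)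
  have hint : ∀ g : sector α → ℂ, Continuous g → Integrable g μ.variation :=
    fun g hg => integrable_of_compact_support hK hμ hg
  set D := cintegral μ fun ξ : sector α => -(ξ : ℂ) * Complex.exp (-z * ξ)
  -- This radius keeps `‖w ξ‖ ≤ 1` on `K`, the range where `‖exp v - 1 - v‖ ≤ ‖v‖ ^ 2`.
  refine (hasDerivAt_of_norm_sub_le_sq (D := D) (δ := (|R| + 1)⁻¹)
    (C := |C| * (|R| + 1) ^ 2 * μ.variation.real univ) (by positivity) fun w hw => ?_).differentiableAt
  have h1 : laplace μ (z + w) - laplace μ z - w • D = cintegral μ fun ξ : sector α =>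
      (Complex.exp (-(z + w) * ξ) - Complex.exp (-z * ξ)) -
        w • (-(ξ : ℂ) * Complex.exp (-z * ξ)) := by
    rw [cintegral_sub (hint _ (by fun_prop)) (hint _ (by fun_prop)),
      cintegral_sub (hint _ (by fun_prop)) (hint _ (by fun_prop)),
      cintegral_const_smul _ (hint _ (by fun_prop))]
    rfl
  rw [h1]
  refine (norm_cintegral_le hK hμ (C := |C| * (|R| + 1) ^ 2 * ‖w‖ ^ 2) (by positivity)
    fun ξ hξ => ?_).trans (le_of_eq (by ring))
  have h2 : Complex.exp (-(z + w) * ξ) - Complex.exp (-z * ξ) -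
      w • (-(ξ : ℂ) * Complex.exp (-z * ξ)) =
      Complex.exp (-z * ξ) * (Complex.exp (-w * ξ) - 1 - (-w * ξ)) := by
    rw [show -(z + w) * (ξ : ℂ) = -z * ξ + -w * ξ by ring, Complex.exp_add, smul_eq_mul]; ring
  have h3 : ‖-w * (ξ : ℂ)‖ ≤ (|R| + 1) * ‖w‖ := by
    rw [norm_mul, norm_neg, mul_comm]
    gcongr
    linarith [hR ξ hξ, le_abs_self R]
  have h4 : (|R| + 1) * ‖w‖ ≤ 1 := by
    have := mul_le_mul_of_nonneg_left hw.le (by positivity : 0 ≤ |R| + 1)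
    rwa [mul_inv_cancel₀ (by positivity)] at this
  rw [h2, norm_mul, mul_assoc, ← mul_pow]
  gcongr
  · exact (hC ξ hξ).trans (le_abs_self C)
  · exact (Complex.norm_exp_sub_one_sub_id_le (h3.trans h4)).trans (by gcongr)

end Laplace

/-! ### Maximum principle in a sector symmetric about the real axis -/

/-- Both `f` and its conjugate reflection are entire, and they agree at the points `1 + 1/(n+1)`,
which accumulate at `1`; the identity theorem applies. -/
theorem conj_symm_of_real_on_pos {f : ℂ → ℂ} (hf : Differentiable ℂ f)
    (hreal : ∀ x : ℝ, 0 < x → (f x).im = 0) (z : ℂ) :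
    f (starRingEnd ℂ z) = starRingEnd ℂ (f z) := by
  set g : ℂ → ℂ := fun z => starRingEnd ℂ (f (starRingEnd ℂ z))
  have hg : Differentiable ℂ g := fun z => by
    have := (hf (starRingEnd ℂ z)).conj_conj
    rwa [Complex.conj_conj] at this
  have hfg : f = g := by
    refine AnalyticOnNhd.eq_of_frequently_eq (𝕜 := ℂ) (z₀ := 1) (fun x _ => hf.analyticAt x)
      (fun x _ => hg.analyticAt x) ?_
    have ht : Tendsto (fun n : ℕ => ((1 + 1 / ((n : ℝ) + 1) : ℝ) : ℂ)) atTop (𝓝[≠] 1) := by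
      refine tendsto_nhdsWithin_iff.2 ⟨?_, Eventually.of_forall fun n => ?_⟩
      · have := (tendsto_one_div_add_atTop_nhds_zero_nat (𝕜 := ℝ)).const_add 1
        rw [add_zero] at this
        exact (Complex.continuous_ofReal.tendsto' (1 : ℝ) 1 Complex.ofReal_one).comp this
      · have : (0 : ℝ) < 1 / ((n : ℝ) + 1) := by positivity
        rw [mem_compl_iff, mem_singleton_iff, Complex.ofReal_eq_one]
        linarith
    refine ht.frequently (Frequently.of_forall fun n => ?_)
    have h := hreal (1 + 1 / ((n : ℝ) + 1)) (by positivity)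
    simp only [g, Complex.conj_ofReal]
    exact (Complex.conj_eq_iff_im.2 h).symm
  have := congrFun hfg (starRingEnd ℂ z)
  simpa [g] using this

/-- Maximum principle on the cone between the rays through `z` and its conjugate, cut off at radius
`R`. The strict bound on the rays becomes uniform because the truncated rays are compact; beyond `R`
the bound `M / 2` takes over. -/
theorem exists_lt_bound_on_pos {f : ℂ → ℂ} (hf : Differentiable ℂ f) (hf₀ : f 0 = 0)
    (hconj : ∀ z, ‖f (starRingEnd ℂ z)‖ = ‖f z‖) {z : ℂ} (hz : 0 < z.re) {M R : ℝ} (hM : 0 < M)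
    (hR : 0 < R)
    (hfar : ∀ w : ℂ, |w.im| * z.re ≤ |z.im| * w.re → 0 ≤ w.re → R ≤ ‖w‖ →
      ‖f w‖ ≤ M / 2)
    (hray : ∀ t : ℝ, 0 < t → ‖f (t * z)‖ < M) :
    ∃ m < M, ∀ x : ℝ, 0 < x → ‖f x‖ ≤ m := by
  -- The two truncated rays. The condition `0 ≤ w.re` matters for real `z`, where the equation alone
  -- describes the whole real line.
  set S : Set ℂ := {w | |w.im| * z.re = |z.im| * w.re ∧ 0 ≤ w.re} ∩ Metric.closedBall 0 R
  have hre : ∀ w : ℂ, |w.im| * z.re ≤ |z.im| * w.re → z.im ≠ 0 → 0 ≤ w.re := by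
    intro w hw hzi
    by_contra h
    have h1 : 0 < |z.im| := abs_pos.2 hzi
    nlinarith [mul_nonneg (abs_nonneg w.im) hz.le]
  have hScl : IsCompact S := by
    refine (isCompact_closedBall (0 : ℂ) R).inter_left ?_
    have h1 : IsClosed {w : ℂ | |w.im| * z.re = |z.im| * w.re} :=
      isClosed_eq (by fun_prop) (by fun_prop)
    have h2 : IsClosed {w : ℂ | 0 ≤ w.re} := isClosed_le (by fun_prop) (by fun_prop)
    exact h1.inter h2
  have hSM : ∀ w ∈ S, ‖f w‖ < M := by
    rintro w ⟨⟨hw, hw0⟩, -⟩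
    rcases hw0.eq_or_lt with h0 | h0
    · have hi : w.im = 0 := by
        rw [← h0, mul_zero] at hw
        simpa [hz.ne'] using hw
      have : w = 0 := Complex.ext h0.symm hi
      simpa [this, hf₀] using hM
    · have ht : 0 < w.re / z.re := div_pos h0 hz
      have habs : |w.im| = |w.re / z.re * z.im| := by
        rw [abs_mul, abs_of_pos ht]; field_simp; linarith
      rcases abs_eq_abs.1 habs with h | h
      · have : w = ((w.re / z.re : ℝ) : ℂ) * z := by
          apply Complex.ext
          · rw [Complex.re_ofReal_mul]; field_simp
          · rw [Complex.im_ofReal_mul]; exact h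
        rw [this]; exact hray _ ht
      · have : w = starRingEnd ℂ (((w.re / z.re : ℝ) : ℂ) * z) := by
          apply Complex.ext
          · rw [Complex.conj_re, Complex.re_ofReal_mul]; field_simp
          · rw [Complex.conj_im, Complex.im_ofReal_mul]; exact h
        rw [this, hconj]; exact hray _ ht
  have h0S : (0 : ℂ) ∈ S := by simp [S, hR.le]
  obtain ⟨w₀, hw₀, hmax⟩ := hScl.exists_isMaxOn ⟨0, h0S⟩ hf.continuous.norm.continuousOn
  refine ⟨max ‖f w₀‖ (M / 2), max_lt (hSM _ hw₀) (by linarith), fun x hx => ?_⟩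
  rcases le_or_gt R x with hxR | hxR
  · refine (hfar x ?_ (by simpa using hx.le) (by simpa [abs_of_pos hx] using hxR)).trans (le_max_right _ _)
    simp only [Complex.ofReal_im, abs_zero, zero_mul, Complex.ofReal_re]
    positivity
  -- For real `z` the cone has no interior: it is the ray itself, and `x` already lies in `S`.
  by_cases hzi : z.im = 0
  · refine le_max_of_le_left (hmax ⟨⟨by simp [hzi], by simpa using hx.le⟩, ?_⟩)
    simpa [abs_of_pos hx] using hxR.le
  set U : Set ℂ := {w | |w.im| * z.re < |z.im| * w.re} ∩ Metric.ball 0 R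
  have hUo : IsOpen U :=
    (isOpen_lt (by fun_prop) (by fun_prop)).inter Metric.isOpen_ball
  have hUc : closure U ⊆ {w | |w.im| * z.re ≤ |z.im| * w.re} ∩ Metric.closedBall 0 R := by
    refine closure_minimal (fun w hw => ⟨mem_ofPred.2 (mem_ofPred.1 hw.1).le, Metric.ball_subset_closedBall hw.2⟩) ?_
    exact (isClosed_le (by fun_prop) (by fun_prop)).inter Metric.isClosed_closedBall
  refine Complex.norm_le_of_forall_mem_frontier_norm_le (U := U)
    (Metric.isBounded_ball.subset inter_subset_right) hf.diffContOnCl (fun w hw => ?_)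
    (subset_closure ⟨?_, ?_⟩)
  · have hwc := hUc (frontier_subset_closure hw)
    rw [hUo.frontier_eq] at hw
    rcases le_or_gt R ‖w‖ with h | h
    · exact le_max_of_le_right (hfar w hwc.1 (hre w hwc.1 hzi) h)
    · refine le_max_of_le_left (hmax ⟨⟨?_, hre w hwc.1 hzi⟩, hwc.2⟩)
      by_contra hne
      exact hw.2 ⟨lt_of_le_of_ne hwc.1 hne, by simpa using h⟩
  · simp only [mem_ofPred_eq, Complex.ofReal_im, abs_zero, zero_mul, Complex.ofReal_re]
    have := abs_pos.2 hzi
    positivity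
  · simpa [abs_of_pos hx] using hxR

/-- A point of the closed sector spanned by `z` and its conjugate is a combination of the two with
nonnegative coefficients. -/
theorem exists_combination_of_mem_cone {z w : ℂ} (hz : 0 < z.re)
    (hw : |w.im| * z.re ≤ |z.im| * w.re) (hw₀ : 0 ≤ w.re) :
    ∃ a b : ℝ, 0 ≤ a ∧ 0 ≤ b ∧ w = a * z + b * starRingEnd ℂ z := by
  by_cases hzi : z.im = 0
  · have hwi : w.im = 0 := by
      rw [hzi, abs_zero, zero_mul] at hw
      have := abs_nonneg w.im
      exact abs_eq_zero.1 (le_antisymm (by nlinarith) this)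
    refine ⟨w.re / z.re, 0, by positivity, le_rfl, Complex.ext ?_ ?_⟩
    · simp; field_simp
    · simp [hzi, hwi]
  · have hp := abs_pos.2 hzi
    have h : |w.im / z.im| ≤ w.re / z.re := by
      rw [abs_div, div_le_div_iff₀ hp hz]; linarith
    obtain ⟨h1, h2⟩ := abs_le.1 h
    refine ⟨(w.re / z.re + w.im / z.im) / 2, (w.re / z.re - w.im / z.im) / 2, by linarith,
      by linarith, Complex.ext ?_ ?_⟩
    · simp; field_simp; ring
    · simp; field_simp; ring

/-! ### Boundedness of the exponents -/

section Bounded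

variable {α : ℝ} {μ : ComplexMeasure (sector α)} {K : Set (sector α)}

theorem supOnPos_laplace_ne_top (hK : IsCompact K)
    (hμ : ∀ E, MeasurableSet E → Disjoint E K → μ E = 0) : supOnPos (laplace μ) ≠ ∞ := by
  refine ne_top_of_le_ne_top (ENNReal.ofReal_ne_top (r := μ.variation.real univ))
    (iSup₂_le fun x hx => ?_)
  rw [← ofReal_norm]
  refine ENNReal.ofReal_le_ofReal ((norm_laplace_le hK hμ (m := 0) fun ξ _ => ?_).trans (by simp))
  rw [Complex.re_ofReal_mul]
  exact mul_nonneg hx.le ξ.2.1.le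

/-- An exponent `c` of large modulus would give a ray through `-c` on which `‖laplace μ‖` stays
below the supremum, inside a cone of exponential decay; `exists_lt_bound_on_pos` then contradicts
the definition of the supremum. -/
theorem bounded_of_enorm_laplace_lt (hK : IsCompact K)
    (hμ : ∀ E, MeasurableSet E → Disjoint E K → μ E = 0) (hμ₀ : μ univ = 0)
    (hreal : ∀ x : ℝ, 0 < x → (laplace μ x).im = 0) {S : Set ℂ} (hKS : ∀ ξ ∈ K, (ξ : ℂ) ∈ S)
    (hSconj : ∀ ξ ∈ S, starRingEnd ℂ ξ ∈ S) (hS₁ : (1 : ℂ) ∈ S) {σ : Set ℂ} {η A : ℝ} (hη : 0 < η)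
    (hσ : ∀ c ∈ σ, ∀ ξ ∈ S, (ξ * c).re + η * ‖c‖ ≤ A) {t₀ : ℝ} (ht₀ : 0 < t₀)
    (hlt : ∀ c ∈ σ, ∀ t : ℝ, 0 < t → t ≤ t₀ → ‖laplace μ (-t * c)‖ₑ < supOnPos (laplace μ)) :
    ∃ C, ∀ c ∈ σ, ‖c‖ ≤ C := by
  rcases σ.eq_empty_or_nonempty with rfl | ⟨c₀, hc₀⟩
  · simp
  have htop := supOnPos_laplace_ne_top hK hμ
  set M := (supOnPos (laplace μ)).toReal with hMdef
  have hM : 0 < M := ENNReal.toReal_pos (pos_of_gt (hlt c₀ hc₀ t₀ ht₀ le_rfl)).ne' htop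
  have hlt' : ∀ c ∈ σ, ∀ t : ℝ, 0 < t → t ≤ t₀ → ‖laplace μ (-t * c)‖ < M := by
    intro c hc t ht htt
    have := hlt c hc t ht htt
    rw [← toReal_enorm]
    exact (ENNReal.toReal_lt_toReal enorm_ne_top htop).2 this
  set V := μ.variation.real univ
  obtain ⟨R, hR, hRV⟩ : ∃ R : ℝ, 0 < R ∧ Real.exp (-(η / 2 * R)) * V ≤ M / 2 := by
    have h : Tendsto (fun R : ℝ => Real.exp (-(η / 2 * R)) * V) atTop (𝓝 (0 * V)) :=
      (Real.tendsto_exp_neg_atTop_nhds_zero.comp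
        (tendsto_id.const_mul_atTop (by positivity : 0 < η / 2))).mul_const V
    rw [zero_mul] at h
    have h2 := (h.eventually (ge_mem_nhds (by linarith : (0 : ℝ) < M / 2))).and
      (eventually_gt_atTop (0 : ℝ))
    obtain ⟨R, h3, h4⟩ := h2.exists
    exact ⟨R, h4, h3⟩
  -- Beyond `2A/η`, the bound `A` is absorbed by half of `η‖c‖`, leaving decay at rate `η/2`. Beyond
  -- `R/t₀`, the points `t z` with `t > t₀` have norm at least `R`.
  refine ⟨max (2 * A / η) (R / t₀), fun c hc => ?_⟩
  by_contra! hcC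
  have hc1 : 2 * A / η < ‖c‖ := (le_max_left _ _).trans_lt hcC
  have hc2 : R / t₀ < ‖c‖ := (le_max_right _ _).trans_lt hcC
  have hcpos : 0 < ‖c‖ := (div_pos hR ht₀).trans hc2
  set z := -c
  have hzn : ‖z‖ = ‖c‖ := norm_neg c
  have hcone : ∀ ξ ∈ S, η / 2 * ‖z‖ ≤ (z * ξ).re := by
    intro ξ hξ
    have h1 := hσ c hc ξ hξ
    rw [div_lt_iff₀ hη] at hc1
    have h2 : (z * ξ).re = -(ξ * c).re := by
      rw [← Complex.neg_re]; congr 1; simp only [z]; ring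
    rw [h2, hzn]
    linarith
  have hzre : 0 < z.re := by
    have := hcone 1 hS₁
    rw [mul_one] at this
    exact lt_of_lt_of_le (by rw [hzn]; positivity) this
  have hfar : ∀ w : ℂ, |w.im| * z.re ≤ |z.im| * w.re → 0 ≤ w.re → R ≤ ‖w‖ →
      ‖laplace μ w‖ ≤ M / 2 := by
    intro w hw hw0 hwR
    obtain ⟨a, b, ha, hb, rfl⟩ := exists_combination_of_mem_cone hzre hw hw0
    refine (norm_laplace_le hK hμ (m := η / 2 * R) fun ξ hξ => ?_).trans hRV
    have h1 := hcone ξ (hKS ξ hξ)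
    have h2 := hcone _ (hSconj ξ (hKS ξ hξ))
    -- The conjugate is moved from `z` to `ξ`; this is where the invariance of `S` under conjugation
    -- is needed.
    have h3 : (starRingEnd ℂ z * ξ).re = (z * starRingEnd ℂ (ξ : ℂ)).re := by
      simp [Complex.mul_re]
    have h4 : ‖(a : ℂ) * z + b * starRingEnd ℂ z‖ ≤ a * ‖z‖ + b * ‖z‖ := by
      refine (norm_add_le _ _).trans (le_of_eq ?_)
      simp [abs_of_nonneg ha, abs_of_nonneg hb]
    have h5 : (((a : ℂ) * z + b * starRingEnd ℂ z) * ξ).re =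
        a * (z * ξ).re + b * (starRingEnd ℂ z * ξ).re := by
      rw [add_mul, Complex.add_re, mul_assoc, mul_assoc, Complex.re_ofReal_mul,
        Complex.re_ofReal_mul]
    rw [h5, h3]
    calc η / 2 * R ≤ η / 2 * (a * ‖z‖ + b * ‖z‖) := by
          gcongr; exact hwR.trans h4
      _ = a * (η / 2 * ‖z‖) + b * (η / 2 * ‖z‖) := by ring
      _ ≤ _ := by gcongr
  have hf := differentiable_laplace hK hμ
  have hray : ∀ t : ℝ, 0 < t → ‖laplace μ (t * z)‖ < M := by
    intro t ht
    rcases le_or_gt t t₀ with h | h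
    · simpa [z] using hlt' c hc t ht h
    · refine (hfar _ (le_of_eq ?_) ?_ ?_).trans_lt (by linarith)
      · rw [Complex.re_ofReal_mul, Complex.im_ofReal_mul, abs_mul, abs_of_pos ht]; ring
      · rw [Complex.re_ofReal_mul]; positivity
      · rw [norm_mul, Complex.norm_real, Real.norm_of_nonneg ht.le, hzn]
        rw [div_lt_iff₀ ht₀] at hc2
        nlinarith
  obtain ⟨m, hm, hmx⟩ := exists_lt_bound_on_pos hf (laplace_zero hμ₀)
    (fun z => by rw [conj_symm_of_real_on_pos hf hreal, RCLike.norm_conj]) hzre hM hR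
    hfar hray
  have : supOnPos (laplace μ) ≤ ENNReal.ofReal m := by
    refine iSup₂_le fun x hx => ?_
    rw [← ofReal_norm]
    exact ENNReal.ofReal_le_ofReal (hmx x hx)
  have h0m : 0 ≤ m := (norm_nonneg _).trans (hmx 1 one_pos)
  exact absurd (ENNReal.toReal_le_of_le_ofReal h0m this) (not_le.2 hm)

end Bounded

/-! ### Idempotents from central binomial series -/

section CentralBinom

open PowerSeries in
-- The generating function `S` satisfies `(1 - 4X)S' = 2S`, so `(1 - 4X)S²` has zero derivative and
-- constant term `1`. Hence `S²` is the geometric series in `4X`.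
theorem sum_centralBinom_mul_centralBinom (n : ℕ) :
    ∑ ij ∈ Finset.HasAntidiagonal.antidiagonal n, ij.1.centralBinom * ij.2.centralBinom = 4 ^ n := by
  set S : ℚ⟦X⟧ := PowerSeries.mk fun n => (n.centralBinom : ℚ)
  have hode : (1 - 4 * X) * d⁄dX ℚ S = 2 * S := by
    ext k
    have h4 : (4 : ℚ⟦X⟧) = C (4 : ℚ) := (map_ofNat C 4).symm
    have h2 : (2 : ℚ⟦X⟧) = C (2 : ℚ) := (map_ofNat C 2).symm
    have hrec : ((k + 1 : ℕ) : ℚ) * (k + 1).centralBinom = 2 * (2 * k + 1) * k.centralBinom := by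
      exact_mod_cast Nat.succ_mul_centralBinom_succ k
    rw [sub_mul, one_mul, map_sub, h4, h2, mul_assoc, coeff_C_mul, coeff_C_mul]
    push_cast at hrec
    rcases k with _ | k
    · simpa [S, coeff_derivative] using hrec
    · rw [coeff_succ_X_mul, coeff_derivative, coeff_derivative]
      simp only [S, coeff_mk]
      push_cast at hrec ⊢
      linear_combination hrec
  have hsq : (1 - 4 * X) * (S * S) = 1 := by
    refine derivative.ext ?_ ?_
    · rw [Derivation.leibniz, Derivation.leibniz]
      have h : d⁄dX ℚ (1 - 4 * X : ℚ⟦X⟧) = -4 := by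
        have h4 : (4 : ℚ⟦X⟧) = C (4 : ℚ) := (map_ofNat C 4).symm
        rw [map_sub, Derivation.leibniz, derivative_X, h4, derivative_C]
        simp
      rw [h, derivative_one]
      simp only [smul_eq_mul]
      linear_combination 2 * S * hode
    · simp [S]
  have hgeo : (1 - 4 * X) * (PowerSeries.mk fun n => (4 : ℚ) ^ n) = 1 := by
    ext k
    have h4 : (4 : ℚ⟦X⟧) = C (4 : ℚ) := (map_ofNat C 4).symm
    rw [sub_mul, one_mul, map_sub, h4, mul_assoc, coeff_C_mul]
    rcases k with _ | k
    · simp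
    · rw [coeff_succ_X_mul]
      simp [coeff_one, pow_succ']
  have hS : S * S = PowerSeries.mk fun n => (4 : ℚ) ^ n := by
    calc S * S = S * S * ((1 - 4 * X) * (PowerSeries.mk fun n => (4 : ℚ) ^ n)) := by
          rw [hgeo, mul_one]
      _ = (1 - 4 * X) * (S * S) * (PowerSeries.mk fun n => (4 : ℚ) ^ n) := by ring
      _ = _ := by rw [hsq, one_mul]
  have := congrArg (coeff n) hS
  rw [coeff_mul] at this
  simp only [S, coeff_mk] at this
  exact_mod_cast this

variable {U : Type*} [NormedCommRing U] [NormedAlgebra ℂ U] [CompleteSpace U]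

theorem eventually_norm_pow_le {y : U} {r : ℝ}
    (h : spectralRadius ℂ y < ENNReal.ofReal r) : ∀ᶠ n : ℕ in atTop, ‖y ^ n‖ ≤ r ^ n := by
  have h1 := (spectrum.pow_norm_pow_one_div_tendsto_nhds_spectralRadius y).eventually_lt_const h
  filter_upwards [h1, eventually_gt_atTop 0] with n hn hn0
  have h2 := (ENNReal.ofReal_lt_ofReal_iff_of_nonneg (by positivity)).1 hn
  calc ‖y ^ n‖ = (‖y ^ n‖ ^ (1 / n : ℝ)) ^ n := by
        rw [one_div, Real.rpow_inv_natCast_pow (norm_nonneg _) hn0.ne']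
    _ ≤ r ^ n := by gcongr

theorem spectralRadius_le_of_forall_character {y : U} {r : ℝ}
    (h : ∀ χ : WeakDual.characterSpace ℂ U, ‖χ y‖ ≤ r) :
    spectralRadius ℂ y ≤ ENNReal.ofReal r := by
  refine iSup₂_le fun k hk => ?_
  obtain ⟨χ, rfl⟩ := WeakDual.CharacterSpace.mem_spectrum_iff_exists.1 hk
  rw [← enorm_eq_nnnorm, ← ofReal_norm]
  exact ENNReal.ofReal_le_ofReal (h χ)

/-- Coefficients growing like `4 ^ n` against a spectral radius below `1/8` leave the geometric
ratio `1/2`. -/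
theorem summable_norm_smul_pow {y : U} (hy : spectralRadius ℂ y < ENNReal.ofReal (1 / 8))
    {b : ℕ → ℂ} {B : ℝ} (hb : ∀ n, ‖b n‖ ≤ B * 4 ^ n) : Summable fun n => ‖b n • y ^ n‖ := by
  refine Summable.of_norm_bounded_eventually_nat (g := fun n => B * (1 / 2 : ℝ) ^ n)
    ((summable_geometric_of_lt_one (by norm_num) (by norm_num)).mul_left B) ?_
  filter_upwards [eventually_norm_pow_le hy] with n hn
  rw [norm_norm, norm_smul]
  calc ‖b n‖ * ‖y ^ n‖ ≤ (B * 4 ^ n) * (1 / 8) ^ n :=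
        mul_le_mul (hb n) hn (norm_nonneg _) ((norm_nonneg _).trans (hb n))
    _ = B * (1 / 2) ^ n := by rw [mul_assoc, ← mul_pow]; norm_num

/-- If every character maps `a` to `0` or close to `1`, then the ideal generated by `a` contains an
idempotent on which a character takes the value `1` as soon as it does not vanish at `a`. -/
theorem exists_isIdempotentElem_mul {a : U}
    (h : ∀ χ : WeakDual.characterSpace ℂ U, χ a = 0 ∨ ‖χ a - 1‖ ≤ 1 / 20) :
    ∃ q : U, IsIdempotentElem (a * q) ∧
      ∀ χ : WeakDual.characterSpace ℂ U, χ a ≠ 0 → χ (a * q) = 1 := by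
  -- Since `(2a - 1)² = 1 - 4y`, the series `s = (1 - 4y)^(-1/2)` gives `((2a - 1)s)² = 1`, and `(1
  -- + (2a - 1)s)/2` is the idempotent sought. The central binomial coefficients are the
  -- coefficients of `s`.
  set y := a * (1 - a) with hy
  have hχy : ∀ χ : WeakDual.characterSpace ℂ U, ‖χ y‖ ≤ 1 / 16 := by
    intro χ
    rw [hy, map_mul, map_sub, map_one, norm_mul]
    rcases h χ with h0 | h1
    · simp [h0]
    · have h2 : ‖χ a‖ ≤ 1 + 1 / 20 := by
        calc ‖χ a‖ = ‖1 + (χ a - 1)‖ := by ring_nf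
          _ ≤ ‖(1 : ℂ)‖ + ‖χ a - 1‖ := norm_add_le _ _
          _ ≤ _ := by rw [norm_one]; gcongr
      rw [norm_sub_rev 1 (χ a)]
      calc ‖χ a‖ * ‖χ a - 1‖ ≤ (1 + 1 / 20) * (1 / 20) := by gcongr
        _ ≤ 1 / 16 := by norm_num
  have hρ : spectralRadius ℂ y < ENNReal.ofReal (1 / 8) :=
    (spectralRadius_le_of_forall_character hχy).trans_lt
      ((ENNReal.ofReal_lt_ofReal_iff (by norm_num)).2 (by norm_num))
  have hbound : ∀ n : ℕ, ‖((n.centralBinom : ℕ) : ℂ)‖ ≤ 4 ^ n := fun n => by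
    rw [Complex.norm_natCast]; exact_mod_cast Nat.centralBinom_le_four_pow n
  have hs : Summable fun n : ℕ => ‖((n.centralBinom : ℕ) : ℂ) • y ^ n‖ :=
    summable_norm_smul_pow hρ (B := 1) fun n => by simpa using hbound n
  have hbound1 : ∀ n : ℕ, ‖(((n + 1).centralBinom : ℕ) : ℂ)‖ ≤ 4 * 4 ^ n := fun n =>
    (hbound (n + 1)).trans (le_of_eq (pow_succ' _ _))
  have hs₁ : Summable fun n : ℕ => ‖(((n + 1).centralBinom : ℕ) : ℂ) • y ^ n‖ :=
    summable_norm_smul_pow hρ hbound1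
  set s := ∑' n : ℕ, ((n.centralBinom : ℕ) : ℂ) • y ^ n with hsdef
  set s₁ := ∑' n : ℕ, (((n + 1).centralBinom : ℕ) : ℂ) • y ^ n with hs₁def
  have hss₁ : s = 1 + y * s₁ := by
    rw [hsdef, hs.of_norm.tsum_eq_zero_add, hs₁def, ← hs₁.of_norm.tsum_mul_left]
    simp [pow_succ']
  have hsq : (1 - (4 : ℂ) • y) * (s * s) = 1 := by
    have h1 : s * s = ∑' n : ℕ, ((4 : ℂ) • y) ^ n := by
      rw [hsdef, tsum_mul_tsum_eq_tsum_sum_antidiagonal_of_summable_norm hs hs]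
      refine tsum_congr fun n => ?_
      rw [smul_pow, ← (by exact_mod_cast sum_centralBinom_mul_centralBinom n :
        ∑ ij ∈ Finset.HasAntidiagonal.antidiagonal n, ((ij.1.centralBinom : ℕ) : ℂ) * ((ij.2.centralBinom : ℕ) : ℂ)
          = 4 ^ n), Finset.sum_smul]
      refine Finset.sum_congr rfl fun ij hij => ?_
      rw [smul_mul_smul_comm, ← pow_add, Finset.HasAntidiagonal.mem_antidiagonal.1 hij]
    rw [h1]
    refine Summable.one_sub_mul_tsum_pow (Summable.of_norm ?_)
    simpa only [smul_pow] using summable_norm_smul_pow hρ (b := fun n => (4 : ℂ) ^ n) (B := 1)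
      (by simp)
  have h4y : (1 - (4 : ℂ) • y) = (2 * a - 1) ^ 2 := by
    have : (4 : ℂ) • y = 4 * y := by
      rw [Algebra.smul_def, map_ofNat]
    rw [this, hy]; ring
  rw [h4y] at hsq
  have hhalf : (2 : U) * algebraMap ℂ U (1 / 2) = 1 := by
    rw [← map_ofNat (algebraMap ℂ U) 2, ← map_mul]; norm_num
  set t := algebraMap ℂ U (1 / 2)
  -- Because `s = 1 + a(1 - a)s₁`, the constant terms cancel and a factor `a` comes out: the
  -- idempotent lies in the ideal generated by `a`.
  have hp : a * (s - t * (1 - a) * s₁) = t * (1 + (2 * a - 1) * s) := by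
    rw [hy] at hss₁
    linear_combination t * hss₁ + (-a * s) * hhalf
  have hidem : IsIdempotentElem (a * (s - t * (1 - a) * s₁)) := by
    rw [hp]
    show t * (1 + (2 * a - 1) * s) * (t * (1 + (2 * a - 1) * s)) = t * (1 + (2 * a - 1) * s)
    linear_combination t ^ 2 * hsq + (1 + (2 * a - 1) * s) * t * hhalf
  refine ⟨s - t * (1 - a) * s₁, hidem, fun χ hχ => ?_⟩
  have h1 : ‖χ a - 1‖ ≤ 1 / 20 := (h χ).resolve_left hχ
  refine (IsIdempotentElem.iff_eq_zero_or_one.1 (hidem.map χ)).resolve_left fun h0 => ?_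
  -- The bound is the sum of `4 · 4ⁿ · 16⁻ⁿ`. It puts `χ s` within `1/3` of `1`; as `χ a` is within
  -- `1/20` of `1`, the vanishing of `1 + (2χ a - 1)χ s` is impossible.
  have hχs₁ : ‖χ s₁‖ ≤ 16 / 3 := by
    have hmap : χ s₁ = ∑' n : ℕ, χ ((((n + 1).centralBinom : ℕ) : ℂ) • y ^ n) :=
      hs₁.of_norm.map_tsum χ (map_continuous χ)
    rw [hmap]
    have hg : HasSum (fun n : ℕ => 4 * (1 / 4 : ℝ) ^ n) (16 / 3) := by
      have := (hasSum_geometric_of_lt_one (r := (1 / 4 : ℝ)) (by norm_num)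
        (by norm_num)).mul_left 4
      norm_num at this ⊢
      exact this
    refine tsum_of_norm_bounded hg fun n => ?_
    rw [map_smul, map_pow, norm_smul, norm_pow]
    calc ‖(((n + 1).centralBinom : ℕ) : ℂ)‖ * ‖χ y‖ ^ n ≤ (4 * 4 ^ n) * (1 / 16) ^ n := by
          gcongr
          · exact hbound1 n
          · exact hχy χ
      _ = 4 * (1 / 4) ^ n := by rw [mul_assoc, ← mul_pow]; norm_num
  have hχs : ‖χ s - 1‖ ≤ 1 / 3 := by
    rw [hss₁, map_add, map_one, map_mul, add_sub_cancel_left, norm_mul]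
    calc ‖χ y‖ * ‖χ s₁‖ ≤ 1 / 16 * (16 / 3) := by gcongr; exact hχy χ
      _ = 1 / 3 := by norm_num
  rw [hp, map_mul] at h0
  have ht : χ t ≠ 0 := by
    intro h
    have := congrArg χ hhalf
    rw [map_mul, h, mul_zero, map_one] at this
    exact zero_ne_one this
  have h3 := (mul_eq_zero.1 h0).resolve_left ht
  rw [map_add, map_mul, map_sub, map_mul, map_one, map_ofNat] at h3
  have h4 : (2 : ℂ) = -((χ s - 1) + 2 * (χ a - 1) * (χ s - 1) + 2 * (χ a - 1)) := by
    linear_combination h3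
  have h5 : (2 : ℝ) ≤ 1 / 3 + 2 * (1 / 20) * (1 / 3) + 2 * (1 / 20) := by
    calc (2 : ℝ) = ‖(2 : ℂ)‖ := by simp
      _ ≤ ‖χ s - 1‖ + ‖2 * (χ a - 1) * (χ s - 1)‖ + ‖2 * (χ a - 1)‖ := by
          refine le_trans (le_of_eq ?_) norm_add₃_le
          rw [← norm_neg (_ + _ + _), ← h4]
      _ ≤ _ := by
          rw [norm_mul, norm_mul, Complex.norm_ofNat]
          gcongr
  norm_num at h5

end CentralBinom

/-! ### Geometry of the sector -/

section Sector

variable {α : ℝ}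

/-- Replacing the argument by a homogeneous inequality makes openness, convexity and stability under
addition visible. -/
theorem mem_sector_iff (hα₀ : 0 < α) (hα₁ : α < Real.pi / 2) {z : ℂ} :
    z ∈ sector α ↔ 0 < z.re ∧ |z.im| < Real.tan α * z.re := by
  refine and_congr_right fun hz => ?_
  have harg := Complex.abs_arg_lt_pi_div_two_iff.2 (Or.inl hz)
  have h0 : z.arg ∈ Ioo (-(Real.pi / 2)) (Real.pi / 2) := abs_lt.1 harg
  have h1 : α ∈ Ioo (-(Real.pi / 2)) (Real.pi / 2) := ⟨by linarith, hα₁⟩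
  have h2 : -α ∈ Ioo (-(Real.pi / 2)) (Real.pi / 2) := ⟨by linarith, by linarith⟩
  rw [abs_lt, ← Real.strictMonoOn_tan.lt_iff_lt h2 h0, ← Real.strictMonoOn_tan.lt_iff_lt h0 h1,
    Real.tan_neg, ← abs_lt, Complex.tan_arg, abs_div, abs_of_pos hz, div_lt_iff₀ hz]

theorem sector_eq (hα₀ : 0 < α) (hα₁ : α < Real.pi / 2) :
    sector α = {z : ℂ | 0 < z.re} ∩ {z : ℂ | |z.im| < Real.tan α * z.re} :=
  Set.ext fun _ => mem_sector_iff hα₀ hα₁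

theorem isOpen_sector (hα₀ : 0 < α) (hα₁ : α < Real.pi / 2) : IsOpen (sector α) := by
  rw [sector_eq hα₀ hα₁]
  exact (isOpen_lt (by fun_prop) (by fun_prop)).inter (isOpen_lt (by fun_prop) (by fun_prop))

theorem add_mem_sector (hα₀ : 0 < α) (hα₁ : α < Real.pi / 2) {s t : ℂ} (hs : s ∈ sector α)
    (ht : t ∈ sector α) : s + t ∈ sector α := by
  rw [mem_sector_iff hα₀ hα₁] at *
  refine ⟨add_pos hs.1 ht.1, ?_⟩
  rw [Complex.add_im, Complex.add_re]
  linarith [abs_add_le s.im t.im]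

theorem ofReal_mul_mem_sector {r : ℝ} (hr : 0 < r) {t : ℂ} (ht : t ∈ sector α) :
    (r : ℂ) * t ∈ sector α := by
  refine ⟨?_, ?_⟩
  · rw [Complex.re_ofReal_mul]; exact mul_pos hr ht.1
  · rw [Complex.arg_real_mul _ hr]; exact ht.2

theorem ofReal_mem_sector (hα₀ : 0 < α) {r : ℝ} (hr : 0 < r) : (r : ℂ) ∈ sector α :=
  ⟨by simpa using hr, by rw [Complex.arg_ofReal_of_nonneg hr.le, abs_zero]; exact hα₀⟩

theorem convex_sector (hα₀ : 0 < α) (hα₁ : α < Real.pi / 2) : Convex ℝ (sector α) := by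
  refine convex_iff_forall_pos.2 fun x hx y hy a b ha hb _ => ?_
  simp only [Complex.real_smul]
  exact add_mem_sector hα₀ hα₁ (ofReal_mul_mem_sector ha hx) (ofReal_mul_mem_sector hb hy)

end Sector

/-! ### Invertible and scalar semigroups -/

section Exponential

variable {α : ℝ}

variable {U : Type*} [NormedCommRing U] [NormedAlgebra ℂ U] [CompleteSpace U]

theorem IsAnalyticSemigroup.hasDerivAt {B : Type*} [NonUnitalNormedRing B] [NormedSpace ℂ B]
    [IsScalarTower ℂ B B] [SMulCommClass ℂ B B] {T : ℂ → B} (hT : IsAnalyticSemigroup α T)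
    (hα₀ : 0 < α) (hα₁ : α < Real.pi / 2) {t : ℂ} (ht : t ∈ sector α) :
    HasDerivAt T (deriv T t) t :=
  (hT.differentiableOn.differentiableAt ((isOpen_sector hα₀ hα₁).mem_nhds ht)).hasDerivAt

/-- An analytic semigroup of invertible elements is of the form `exp (t u)`. -/
theorem IsAnalyticSemigroup.exists_eq_exp {V : ℂ → U} (hV : IsAnalyticSemigroup α V)
    (hα₀ : 0 < α) (hα₁ : α < Real.pi / 2) (hunit : ∀ t ∈ sector α, IsUnit (V t)) :
    ∃ u : U, ∀ t ∈ sector α, V t = NormedSpace.exp (t • u) := by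
  have h1 : (1 : ℂ) ∈ sector α := by simpa using ofReal_mem_sector hα₀ one_pos
  have hopen := isOpen_sector hα₀ hα₁
  obtain ⟨v, hv⟩ := (hunit 1 h1).exists_right_inv
  set u := deriv V 1 * v
  -- Differentiating `V(t + 1)` in each of its two summands gives `V(t) V'(1) = V'(t) V(1)`, that
  -- is, `V' = V u`.
  have hderiv : ∀ t ∈ sector α, HasDerivAt V (V t * u) t := by
    intro t ht
    have ht1 := add_mem_sector hα₀ hα₁ ht h1
    have hd := hV.hasDerivAt hα₀ hα₁ ht1
    have ha : HasDerivAt (fun s => V (t + s)) (deriv V (t + 1)) 1 := hd.comp_const_add t 1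
    have hb : HasDerivAt (fun s => V (s + 1)) (deriv V (t + 1)) t := hd.comp_add_const t 1
    have ha' : HasDerivAt (fun s => V (t + s)) (V t * deriv V 1) 1 := by
      refine ((hV.hasDerivAt hα₀ hα₁ h1).const_mul (V t)).congr_of_eventuallyEq ?_
      filter_upwards [hopen.mem_nhds h1] with s hs using hV.map_add t ht s hs
    have hb' : HasDerivAt (fun s => V (s + 1)) (deriv V t * V 1) t := by
      refine ((hV.hasDerivAt hα₀ hα₁ ht).mul_const (V 1)).congr_of_eventuallyEq ?_
      filter_upwards [hopen.mem_nhds ht] with s hs using hV.map_add s hs 1 h1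
    have h2 : V t * deriv V 1 = deriv V t * V 1 :=
      (ha'.unique ha).trans (hb.unique hb')
    have h3 : deriv V t = V t * u := by
      calc deriv V t = deriv V t * V 1 * v := by rw [mul_assoc, hv, mul_one]
        _ = V t * u := by rw [← h2, mul_assoc]
    exact h3 ▸ hV.hasDerivAt hα₀ hα₁ ht
  have hW : ∀ t ∈ sector α, HasDerivAt (fun s => NormedSpace.exp (s • -u) * V s) 0 t := by
    intro t ht
    refine ((hasDerivAt_exp_smul_const (-u) t).mul (hderiv t ht)).congr_deriv ?_
    ring
  obtain ⟨k, hk⟩ := hopen.exists_is_const_of_deriv_eq_zero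
    (convex_sector hα₀ hα₁).isPreconnected
    (fun t ht => (hW t ht).differentiableAt.differentiableWithinAt) fun t ht => (hW t ht).deriv
  have hexp : ∀ t : ℂ, NormedSpace.exp (t • u) * NormedSpace.exp (t • -u) = 1 := by
    intro t
    let : NormedAlgebra ℚ U := NormedAlgebra.restrictScalars ℚ ℂ U
    rw [← NormedSpace.exp_add, smul_neg, add_neg_cancel, NormedSpace.exp_zero]
  have hVk : ∀ t ∈ sector α, V t = NormedSpace.exp (t • u) * k := by
    intro t ht
    rw [← hk t ht, ← mul_assoc, hexp, one_mul]
  -- The sector omits `0`, so `k` cannot be read off there. Instead, comparing `V(2)` with `V(1)²`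
  -- and cancelling the invertible `V(1)` gives `E = E k`, with `E` invertible.
  have hk1 : k = 1 := by
    have hE : NormedSpace.exp (((1 : ℂ) + 1) • u) =
        NormedSpace.exp ((1 : ℂ) • u) * NormedSpace.exp ((1 : ℂ) • u) := by
      let : NormedAlgebra ℚ U := NormedAlgebra.restrictScalars ℚ ℂ U
      rw [add_smul, NormedSpace.exp_add]
    have h2 := hV.map_add 1 h1 1 h1
    rw [hVk _ (add_mem_sector hα₀ hα₁ h1 h1), hE] at h2
    set E := NormedSpace.exp ((1 : ℂ) • u)
    have h3 : V 1 * E = V 1 * (E * k) := by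
      rw [hVk 1 h1] at h2 ⊢
      linear_combination h2
    have h4 := (hunit 1 h1).mul_left_cancel h3
    have h5 := hexp 1
    linear_combination (1 - k) * h5 - NormedSpace.exp ((1 : ℂ) • -u) * h4
  exact ⟨u, fun t ht => by rw [hVk t ht, hk1, mul_one]⟩

/-- A zero at `t₁` propagates to `t₁ + S_α`, a neighbourhood of `2t₁`, and then everywhere by the
identity theorem. A semigroup without zeros is invertible. -/
theorem IsAnalyticSemigroup.eq_zero_or_eq_exp {h : ℂ → ℂ} (hh : IsAnalyticSemigroup α h)
    (hα₀ : 0 < α) (hα₁ : α < Real.pi / 2) :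
    (∀ t ∈ sector α, h t = 0) ∨ ∃ c : ℂ, ∀ t ∈ sector α, h t = Complex.exp (t * c) := by
  by_cases hz : ∃ t₁ ∈ sector α, h t₁ = 0
  · obtain ⟨t₁, ht₁, h0⟩ := hz
    left
    have hopen := isOpen_sector hα₀ hα₁
    refine (hh.differentiableOn.analyticOnNhd hopen).eqOn_zero_of_preconnected_of_eventuallyEq_zero
      (convex_sector hα₀ hα₁).isPreconnected (add_mem_sector hα₀ hα₁ ht₁ ht₁) ?_
    have : Tendsto (fun s => s - t₁) (𝓝 (t₁ + t₁)) (𝓝 t₁) := by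
      exact (continuous_sub_right t₁).tendsto' _ _ (by simp)
    filter_upwards [this.eventually (hopen.mem_nhds ht₁)] with s hs
    have := hh.map_add t₁ ht₁ _ hs
    rwa [add_sub_cancel, h0, zero_mul] at this
  · push Not at hz
    obtain ⟨c, hc⟩ := hh.exists_eq_exp hα₀ hα₁ fun t ht => (hz t ht).isUnit
    exact Or.inr ⟨c, fun t ht => by rw [hc t ht, Complex.exp_eq_exp_ℂ, smul_eq_mul]⟩

end Exponential

/-! ### Semigroups with bounded character exponents -/

section BoundedExponents

variable {α : ℝ}

theorem isUnit_of_forall_character_ne_zero {U : Type*} [NormedCommRing U] [NormedAlgebra ℂ U]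
    [CompleteSpace U] {x : U} (h : ∀ χ : WeakDual.characterSpace ℂ U, χ x ≠ 0) : IsUnit x := by
  by_contra hx
  obtain ⟨χ, hχ⟩ := WeakDual.CharacterSpace.mem_spectrum_iff_exists.1
    ((spectrum.zero_mem_iff ℂ).2 hx)
  exact h χ hχ

theorem IsAnalyticSemigroup.comp_character {U : Type*} [NormedCommRing U] [NormedAlgebra ℂ U]
    [CompleteSpace U] {G : ℂ → U} (hG : IsAnalyticSemigroup α G)
    (χ : WeakDual.characterSpace ℂ U) : IsAnalyticSemigroup α fun t => χ (G t) where
  differentiableOn :=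
    (WeakDual.toStrongDual (χ : WeakDual ℂ U)).differentiable.comp_differentiableOn
      hG.differentiableOn
  map_add s hs t ht := by rw [hG.map_add s hs t ht, map_mul]

theorem exists_idempotent_exp {U : Type*} [NormedCommRing U] [NormedAlgebra ℂ U]
    [CompleteSpace U] {G : ℂ → U} (hG : IsAnalyticSemigroup α G)
    (hα₀ : 0 < α) (hα₁ : α < Real.pi / 2)
    (hbdd : ∃ C, ∀ (χ : WeakDual.characterSpace ℂ U) (c : ℂ),
      (∀ t ∈ sector α, χ (G t) = Complex.exp (t * c)) → ‖c‖ ≤ C) :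
    ∃ t₀ ∈ sector α, ∃ q u : U, IsIdempotentElem (G t₀ * q) ∧
      (∀ χ : WeakDual.characterSpace ℂ U, (∃ t ∈ sector α, χ (G t) ≠ 0) → χ (G t₀ * q) = 1) ∧
      ∀ t ∈ sector α, G t * (G t₀ * q) = G t₀ * q * NormedSpace.exp (t • u) := by
  obtain ⟨C, hC⟩ := hbdd
  -- This gives `‖r c‖ ≤ 1/40` for every exponent, hence `‖exp(r c) - 1‖ ≤ 1/20`, as splitting the
  -- spectrum requires.
  set r : ℝ := 1 / (40 * (|C| + 1))
  have hr : 0 < r := by positivity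
  have hrC : r * |C| ≤ 1 / 40 := by
    rw [div_mul_eq_mul_div, div_le_div_iff₀ (by positivity) (by norm_num)]
    linarith
  have ht₀ : (r : ℂ) ∈ sector α := ofReal_mem_sector hα₀ hr
  have hdich := fun χ : WeakDual.characterSpace ℂ U =>
    (hG.comp_character χ).eq_zero_or_eq_exp hα₀ hα₁
  obtain ⟨q, hq, hq1⟩ := exists_isIdempotentElem_mul (a := G r) fun χ => by
    rcases hdich χ with h | ⟨c, hc⟩
    · exact Or.inl (h _ ht₀)
    · right
      rw [hc _ ht₀]
      have hn : ‖(r : ℂ) * c‖ ≤ 1 / 40 := by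
        rw [norm_mul, Complex.norm_real, Real.norm_of_nonneg hr.le]
        refine le_trans ?_ hrC
        gcongr
        exact (hC χ c hc).trans (le_abs_self C)
      calc _ ≤ 2 * ‖(r : ℂ) * c‖ := Complex.norm_exp_sub_one_le (hn.trans (by norm_num))
        _ ≤ 1 / 20 := by linarith
  set p := G r * q
  have hpp : p * p = p := hq
  have hne : ∀ χ : WeakDual.characterSpace ℂ U, (∃ t ∈ sector α, χ (G t) ≠ 0) → χ (G r) ≠ 0 := by
    rintro χ ⟨t, ht, h⟩
    rcases hdich χ with h0 | ⟨c, hc⟩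
    · exact absurd (h0 t ht) h
    · rw [hc _ ht₀]; exact Complex.exp_ne_zero _
  -- Adding `1 - p` makes the semigroup invertible: a character with `χ(p) = 0` sends it to `1`, and
  -- one with `χ(p) = 1` sends it to an exponential.
  have hV : IsAnalyticSemigroup α fun t => G t * p + (1 - p) :=
    { differentiableOn := (hG.differentiableOn.mul_const p).add_const _
      map_add := fun s hs t ht => by
        rw [hG.map_add s hs t ht]
        linear_combination (G s + G t - G s * G t - 1) * hpp }
  obtain ⟨u, hu⟩ := hV.exists_eq_exp hα₀ hα₁ fun t ht =>
    isUnit_of_forall_character_ne_zero fun χ => by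
      rw [map_add, map_mul, map_sub, map_one]
      by_cases h0 : χ (G r) = 0
      · simp [p, h0]
      · rw [hq1 χ h0]
        rcases hdich χ with h | ⟨c, hc⟩
        · exact absurd (h _ ht₀) h0
        · simp [hc t ht, Complex.exp_ne_zero]
  refine ⟨r, ht₀, q, u, hq, fun χ h => hq1 χ (hne χ h), fun t ht => ?_⟩
  rw [← hu t ht]
  linear_combination (1 - G t) * hpp

end BoundedExponents

/-! ### The unitization as a commutative Banach algebra -/

section Unitization

variable {A : Type*} [NonUnitalNormedCommRing A] [NormedSpace ℂ A]
    [IsScalarTower ℂ A A] [SMulCommClass ℂ A A]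

/-- The unitization of a commutative normed algebra, with the `ℓ¹` norm. -/
abbrev L1Unitization (A : Type*) := WithLp 1 (Unitization ℂ A)

noncomputable instance : NormedCommRing (L1Unitization A) :=
  { WithLp.instUnitizationNormedRing with
    mul_comm := fun _ _ => WithLp.ofLp_injective 1 (mul_comm _ _) }

noncomputable instance : NormedAlgebra ℂ (L1Unitization A) :=
  { (WithLp.instUnitizationNormedAlgebra : NormedAlgebra ℂ (WithLp 1 (Unitization ℂ A))) with }

/-- The inclusion of a commutative normed algebra in its unitization. -/
noncomputable def toL1Unitization : A →L[ℂ] L1Unitization A :=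
  LinearMap.mkContinuous
    { toFun := fun a => WithLp.toLp 1 (a : Unitization ℂ A)
      map_add' := fun a b => by simp [Unitization.inr_add]
      map_smul' := fun c a => by simp [Unitization.inr_smul] } 1 fun a => by
    simp [WithLp.unitization_norm_def]

end Unitization

/-! ### Characters, the radical, and the unit of the quotient -/

section Commutative

variable {A : Type*} [NonUnitalNormedCommRing A] [NormedSpace ℂ A]
    [IsScalarTower ℂ A A] [SMulCommClass ℂ A A]

theorem toL1Unitization_apply (a : A) :
    toL1Unitization a = WithLp.toLp 1 (a : Unitization ℂ A) := rfl

theorem toL1Unitization_mul (a b : A) :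
    toL1Unitization (a * b) = toL1Unitization a * toL1Unitization b :=
  WithLp.ofLp_injective 1 (Unitization.inr_mul ℂ a b)

/-- The projection of the unitization onto the algebra. -/
noncomputable def sndL1Unitization : L1Unitization A →L[ℂ] A :=
  LinearMap.mkContinuous
    { toFun := fun x => (WithLp.ofLp x).snd
      map_add' := fun _ _ => rfl
      map_smul' := fun _ _ => rfl } 1 fun x => by
    rw [one_mul, WithLp.unitization_norm_def]
    exact le_add_of_nonneg_left (norm_nonneg _)

@[simp]
theorem sndL1Unitization_toL1Unitization (a : A) : sndL1Unitization (toL1Unitization a) = a := rfl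

/-- The algebra is an ideal of its unitization; this brings the idempotent and the generator,
constructed in the unitization, back into `A`. -/
theorem exists_toL1Unitization_eq_mul (a : A) (x : L1Unitization A) :
    ∃ b : A, toL1Unitization b = toL1Unitization a * x := by
  refine ⟨(WithLp.ofLp x).fst • a + a * (WithLp.ofLp x).snd, WithLp.ofLp_injective 1 ?_⟩
  ext
  · simp [toL1Unitization_apply]
  · simp [toL1Unitization_apply]

/-- The spectrum consists of the character values, so identities modulo the radical can be checked
on characters. -/
theorem mem_radical_of_forall_character [CompleteSpace A] {a : A}
    (h : ∀ χ : WeakDual.characterSpace ℂ (L1Unitization A), χ (toL1Unitization a) = 0) :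
    a ∈ radical A := by
  rw [mem_radical_iff, specRadius]
  refine le_antisymm (iSup₂_le fun z hz => ?_) bot_le
  rw [Unitization.quasispectrum_eq_spectrum_inr,
    ← AlgEquiv.spectrum_eq (WithLp.unitizationAlgEquiv (𝕜 := ℂ) (A := A) ℂ).symm] at hz
  obtain ⟨χ, rfl⟩ := WeakDual.CharacterSpace.mem_spectrum_iff_exists.1 hz
  simpa using! (congrArg enorm (h χ)).le

theorem toModRad_eq_of_forall_character [CompleteSpace A] {a b : A}
    (h : ∀ χ : WeakDual.characterSpace ℂ (L1Unitization A),
      χ (toL1Unitization a) = χ (toL1Unitization b)) : toModRad A a = toModRad A b := by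
  refine (Submodule.Quotient.eq _).2 (mem_radical_of_forall_character fun χ => ?_)
  rw [map_sub, map_sub, h χ, sub_self]

theorem toModRad_powWith (p u : A) (k : ℕ) :
    toModRad A (powWith p u k) = powWith (toModRad A p) (toModRad A u) k := by
  induction k with
  | zero => rfl
  | succ k ih => rw [powWith, powWith, toModRad_mul, ih]

theorem continuous_toModRad : Continuous (toModRad A) := continuous_quot_mk

/-- A character either kills the semigroup, hence all of `A` by `hgen`, or takes the value `1` at
`p`. In both cases it kills `p a - a`, so the class of `p` is the identity. -/
theorem exists_identity_and_bounded_generator [CompleteSpace A] {α : ℝ} (hα₀ : 0 < α)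
    (hα₁ : α < Real.pi / 2) {T : ℂ → A} (hT : IsAnalyticSemigroup α T)
    (hgen : ∀ χ : WeakDual.characterSpace ℂ (L1Unitization A),
      (∀ t ∈ sector α, χ (toL1Unitization (T t)) = 0) → ∀ a : A, χ (toL1Unitization a) = 0)
    (hbdd : ∃ C, ∀ (χ : WeakDual.characterSpace ℂ (L1Unitization A)) (c : ℂ),
      (∀ t ∈ sector α, χ (toL1Unitization (T t)) = Complex.exp (t * c)) → ‖c‖ ≤ C) :
    ∃ e : ModRad A, IsIdentity e ∧ ∃ u : ModRad A, ∀ t ∈ sector α,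
      HasSum (fun k : ℕ => (t ^ k / (k.factorial : ℂ)) • powWith e u k) (toModRad A (T t)) := by
  have hG : IsAnalyticSemigroup α fun t => toL1Unitization (T t) :=
    { differentiableOn := toL1Unitization.differentiable.comp_differentiableOn hT.differentiableOn
      map_add := fun s hs t ht => by rw [hT.map_add s hs t ht, toL1Unitization_mul] }
  obtain ⟨t₀, ht₀, q, v, hidem, hχ, hexp⟩ := exists_idempotent_exp hG hα₀ hα₁ hbdd
  obtain ⟨p, hp⟩ := exists_toL1Unitization_eq_mul (T t₀) q
  rw [← hp] at hidem hχ hexp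
  obtain ⟨u, hu⟩ := exists_toL1Unitization_eq_mul p v
  have hχp : ∀ (χ : WeakDual.characterSpace ℂ (L1Unitization A)) (a : A),
      χ (toL1Unitization p) * χ (toL1Unitization a) = χ (toL1Unitization a) := by
    intro χ a
    by_cases h : ∀ t ∈ sector α, χ (toL1Unitization (T t)) = 0
    · rw [hgen χ h a, mul_zero]
    · push Not at h
      rw [hχ χ h, one_mul]
  have hid : ∀ a : A, toModRad A (p * a) = toModRad A a := fun a =>
    toModRad_eq_of_forall_character fun χ => by rw [toL1Unitization_mul, map_mul, hχp]
  refine ⟨toModRad A p, ?_, toModRad A u, fun t ht => ?_⟩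
  · intro x
    obtain ⟨a, rfl⟩ := (radical A).mkQ_surjective x
    change toModRad A p * toModRad A a = toModRad A a ∧ toModRad A a * toModRad A p = toModRad A a
    rw [← toModRad_mul, ← toModRad_mul, mul_comm a p]
    exact ⟨hid a, hid a⟩
  -- With `u = p v` and `p² = p`, the powers of `u` relative to the identity `p` are `p v ^ k`, so
  -- the exponential series of `v` times `p` is the required series.
  · have hpow : ∀ k, toL1Unitization (powWith p u k) = toL1Unitization p * v ^ k := by
      intro k
      induction k with
      | zero => simp [powWith]
      | succ k ih =>
        rw [powWith, toL1Unitization_mul, ih, hu, pow_succ]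
        linear_combination v ^ k * v * hidem.eq
    have hsum : HasSum (fun k : ℕ => (t ^ k / (k.factorial : ℂ)) • toL1Unitization (powWith p u k))
        (toL1Unitization (p * T t)) := by
      have h1 := (NormedSpace.exp_series_hasSum_exp' (𝕂 := ℂ) (t • v)).mul_left (toL1Unitization p)
      rw [← hexp t ht, mul_comm, ← toL1Unitization_mul] at h1
      convert! h1 using 2 with k
      rw [hpow, smul_pow, smul_smul, mul_smul_comm]
      congr 1
      ring
    have h2 := (hsum.mapL sndL1Unitization).map (toModRad A) continuous_toModRad
    rw [sndL1Unitization_toL1Unitization, hid] at h2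
    convert! h2 using 2 with k
    simp only [Function.comp_apply, map_smul, sndL1Unitization_toL1Unitization, toModRad_powWith]

end Commutative

/-! ### Location of the exponents in the commutative case -/

section CommutativeBounded

variable {A : Type*} [NonUnitalNormedCommRing A] [NormedSpace ℂ A]
    [IsScalarTower ℂ A A] [SMulCommClass ℂ A A] [CompleteSpace A] {α : ℝ}

theorem norm_character_toL1Unitization_le (χ : WeakDual.characterSpace ℂ (L1Unitization A))
    (a : A) : ‖χ (toL1Unitization a)‖ ≤ ‖a‖ * ‖(1 : L1Unitization A)‖ := by
  have h := spectrum.norm_le_norm_mul_of_mem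
    (WeakDual.CharacterSpace.mem_spectrum_iff_exists.2 ⟨χ, rfl⟩ :
      χ (toL1Unitization a) ∈ spectrum ℂ (toL1Unitization a))
  rwa [show ‖(toL1Unitization a : L1Unitization A)‖ = ‖a‖ from WithLp.unitization_norm_inr a] at h

theorem IsAnalyticSemigroup.continuous_ofReal_mul {B : Type*} [NonUnitalNormedRing B]
    [NormedSpace ℂ B] [IsScalarTower ℂ B B] [SMulCommClass ℂ B B] {T : ℂ → B}
    (hT : IsAnalyticSemigroup α T) {t : ℝ} (ht : 0 < t) :
    Continuous fun ξ : sector α => T (t * ξ) :=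
  hT.differentiableOn.continuousOn.comp_continuous (by fun_prop)
    fun ξ => ofReal_mul_mem_sector ht ξ.2

theorem character_funcCalc {μ : ComplexMeasure (sector α)} {K : Set (sector α)} (hK : IsCompact K)
    (hμ : ∀ E, MeasurableSet E → Disjoint E K → μ E = 0) {T : ℂ → A}
    (hT : IsAnalyticSemigroup α T) {χ : WeakDual.characterSpace ℂ (L1Unitization A)} {c : ℂ}
    (hc : ∀ t ∈ sector α, χ (toL1Unitization (T t)) = Complex.exp (t * c)) {t : ℝ} (ht : 0 < t) :
    χ (toL1Unitization (funcCalc μ T t)) = laplace μ (-t * c) := by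
  refine (map_cintegral ((WeakDual.toStrongDual (χ : WeakDual ℂ (L1Unitization A))).comp
    toL1Unitization) (integrable_of_compact_support hK hμ (hT.continuous_ofReal_mul ht))).trans ?_
  refine congrArg (cintegral μ) (funext fun ξ => ?_)
  refine (hc _ (ofReal_mul_mem_sector ht ξ.2)).trans ?_
  congr 1
  ring

/-- The exponents of the characters lie, up to a bounded set, in a sector opposite to `S`. -/
theorem exists_re_mul_add_le (hα₀ : 0 < α) (hα₁ : α < Real.pi / 2) {T : ℂ → A}
    (hT : IsAnalyticSemigroup α T) {S : Set ℂ} (hS : IsCompact S) (hSα : S ⊆ sector α) :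
    ∃ η : ℝ, 0 < η ∧ ∃ M : ℝ, ∀ (χ : WeakDual.characterSpace ℂ (L1Unitization A)) (c : ℂ),
      (∀ t ∈ sector α, χ (toL1Unitization (T t)) = Complex.exp (t * c)) →
      ∀ ξ ∈ S, (ξ * c).re + η * ‖c‖ ≤ M := by
  obtain ⟨η, hη, hηS⟩ := hS.exists_cthickening_subset_open (isOpen_sector hα₀ hα₁) hSα
  obtain ⟨N, hN⟩ := hS.cthickening.exists_bound_of_continuousOn
    (hT.differentiableOn.continuousOn.mono hηS)
  refine ⟨η, hη, Real.log (max (N * ‖(1 : L1Unitization A)‖) 1), fun χ c hc ξ hξ => ?_⟩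
  -- Among the points at distance at most `η` from `ξ`, this one maximizes `Re(tc)`. For `c = 0` the
  -- quotient is `0` and `t = ξ`.
  set t := ξ + η * (starRingEnd ℂ c / ‖c‖)
  have htc : t ∈ Metric.cthickening η S := by
    refine Metric.mem_cthickening_of_dist_le _ ξ η S hξ ?_
    rw [dist_eq_norm, add_sub_cancel_left, norm_mul, Complex.norm_real, norm_div, RCLike.norm_conj,
      Complex.norm_real, norm_norm, Real.norm_of_nonneg hη.le]
    exact mul_le_of_le_one_right hη.le (div_self_le_one _)
  have hre : (t * c).re = (ξ * c).re + η * ‖c‖ := by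
    have h1 : starRingEnd ℂ c / ‖c‖ * c = (‖c‖ : ℂ) := by
      rcases eq_or_ne c 0 with rfl | h0
      · simp
      · have : (‖c‖ : ℂ) ≠ 0 := by simpa using h0
        rw [div_mul_eq_mul_div, mul_comm, Complex.mul_conj', sq, mul_div_assoc, div_self this,
          mul_one]
    rw [add_mul, mul_assoc, h1, Complex.add_re, Complex.re_ofReal_mul, Complex.ofReal_re]
  rw [← hre, Real.le_log_iff_exp_le (by positivity), ← Complex.norm_exp, ← hc t (hηS htc)]
  refine (norm_character_toL1Unitization_le χ _).trans (le_max_of_le_left ?_)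
  gcongr
  exact hN t htc

theorem exists_bounded_generator_of_enorm_character_lt (hα₀ : 0 < α) (hα₁ : α < Real.pi / 2)
    {μ : ComplexMeasure (sector α)} (hsupp : HasCompactSupp μ) (hμ₀ : μ univ = 0)
    (hreal : ∀ x : ℝ, 0 < x → (laplace μ x).im = 0) {T : ℂ → A} (hT : IsAnalyticSemigroup α T)
    (hgen : ∀ χ : WeakDual.characterSpace ℂ (L1Unitization A),
      (∀ t ∈ sector α, χ (toL1Unitization (T t)) = 0) → ∀ a : A, χ (toL1Unitization a) = 0)
    {t₀ : ℝ} (ht₀ : 0 < t₀) (hlt : ∀ (χ : WeakDual.characterSpace ℂ (L1Unitization A)) (t : ℝ),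
      0 < t → t ≤ t₀ → ‖χ (toL1Unitization (funcCalc μ T t))‖ₑ < supOnPos (laplace μ)) :
    ∃ e : ModRad A, IsIdentity e ∧ ∃ u : ModRad A, ∀ t ∈ sector α,
      HasSum (fun k : ℕ => (t ^ k / (k.factorial : ℂ)) • powWith e u k) (toModRad A (T t)) := by
  refine exists_identity_and_bounded_generator hα₀ hα₁ hT hgen ?_
  obtain ⟨K, hK, hμ⟩ := hsupp
  set K' : Set ℂ := Subtype.val '' K
  have hK' : IsCompact K' := hK.image continuous_subtype_val
  -- Conjugates are included because the cone involves both `z` and its conjugate; the point `1`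
  -- forces `Re z > 0`.
  set S : Set ℂ := K' ∪ starRingEnd ℂ '' K' ∪ {1}
  have hS : IsCompact S := (hK'.union (hK'.image Complex.continuous_conj)).union isCompact_singleton
  have hSα : S ⊆ sector α := by
    rintro _ ((⟨ξ, -, rfl⟩ | ⟨_, ⟨ξ, -, rfl⟩, rfl⟩) | rfl)
    · exact ξ.2
    · exact conj_mem_sector ξ.2
    · simpa using ofReal_mem_sector hα₀ one_pos
  obtain ⟨η, hη, M, hM⟩ := exists_re_mul_add_le hα₀ hα₁ hT hS hSα
  obtain ⟨C, hC⟩ := bounded_of_enorm_laplace_lt hK hμ hμ₀ hreal (S := S)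
    (σ := {c | ∃ χ : WeakDual.characterSpace ℂ (L1Unitization A),
      ∀ t ∈ sector α, χ (toL1Unitization (T t)) = Complex.exp (t * c)})
    (fun ξ hξ => Or.inl (Or.inl ⟨ξ, hξ, rfl⟩))
    (by
      rintro _ ((⟨ξ, h, rfl⟩ | ⟨_, ⟨ξ, h, rfl⟩, rfl⟩) | rfl)
      · exact Or.inl (Or.inr ⟨_, ⟨ξ, h, rfl⟩, rfl⟩)
      · exact Or.inl (Or.inl ⟨ξ, h, (Complex.conj_conj _).symm⟩)
      · exact Or.inr (map_one _))
    (Or.inr rfl) hη (fun c ⟨χ, hχ⟩ ξ hξ => hM χ c hχ ξ hξ) ht₀ (fun c ⟨χ, hχ⟩ t ht htt => by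
      rw [← character_funcCalc hK hμ hT hχ ht]
      exact hlt χ t ht htt)
  exact ⟨C, fun χ c hχ => hC c ⟨χ, hχ⟩⟩

end CommutativeBounded

/-! ### Spectral radius under isometric embeddings -/

section SpectralRadius

variable {A B : Type*} [NonUnitalNormedRing A] [NormedSpace ℂ A] [IsScalarTower ℂ A A]
  [SMulCommClass ℂ A A] [NonUnitalNormedRing B] [NormedSpace ℂ B]
  [IsScalarTower ℂ B B] [SMulCommClass ℂ B B]

theorem specRadius_eq_spectralRadius (a : A) :
    specRadius a = spectralRadius ℂ (WithLp.toLp 1 (a : Unitization ℂ A)) := by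
  have h : spectrum ℂ (WithLp.toLp 1 (a : Unitization ℂ A)) = spectrum ℂ (a : Unitization ℂ A) :=
    AlgEquiv.spectrum_eq (WithLp.unitizationAlgEquiv (𝕜 := ℂ) (A := A) ℂ).symm
      (a : Unitization ℂ A)
  rw [specRadius, spectralRadius, h, Unitization.quasispectrum_eq_spectrum_inr]
  rfl

variable [CompleteSpace A]

theorem specRadius_le_enorm (a : A) : specRadius a ≤ ‖a‖ₑ := by
  rw [specRadius_eq_spectralRadius]
  have : NormOneClass (WithLp 1 (Unitization ℂ A)) := ⟨by
    rw [WithLp.unitization_norm_def]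
    change ‖(1 : ℂ)‖ + ‖(0 : A)‖ = 1
    simp⟩
  refine (spectrum.spectralRadius_le_nnnorm _).trans (le_of_eq ?_)
  rw [WithLp.unitization_nnnorm_inr]
  rfl

/-- Spectra may change between an algebra and a closed subalgebra, but by Gelfand's formula the
spectral radius depends only on the norms of powers. -/
theorem specRadius_eq_of_norm_eq [CompleteSpace B] (j : A →ₙₐ[ℂ] B) (hj : ∀ a, ‖j a‖ = ‖a‖) (a : A) :
    specRadius (j a) = specRadius a := by
  rw [specRadius_eq_spectralRadius, specRadius_eq_spectralRadius]
  -- Only positive exponents: the zeroth power is the adjoined unit, which lies outside `A`.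
  have hpow : ∀ n : ℕ, ∃ b : A,
      (WithLp.toLp 1 (a : Unitization ℂ A)) ^ (n + 1) = WithLp.toLp 1 (b : Unitization ℂ A) ∧
      (WithLp.toLp 1 (j a : Unitization ℂ B)) ^ (n + 1) = WithLp.toLp 1 (j b : Unitization ℂ B) := by
    intro n
    induction n with
    | zero => exact ⟨a, by simp, by simp⟩
    | succ n ih =>
      obtain ⟨b, h1, h2⟩ := ih
      refine ⟨b * a, ?_, ?_⟩
      · rw [pow_succ, h1]
        exact WithLp.ofLp_injective 1 (Unitization.inr_mul ℂ b a).symm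
      · rw [pow_succ, h2, map_mul]
        exact WithLp.ofLp_injective 1 (Unitization.inr_mul ℂ (j b) (j a)).symm
  refine tendsto_nhds_unique
    (spectrum.pow_norm_pow_one_div_tendsto_nhds_spectralRadius _) (Tendsto.congr' ?_
    (spectrum.pow_norm_pow_one_div_tendsto_nhds_spectralRadius
      (WithLp.toLp 1 (a : Unitization ℂ A))))
  filter_upwards [eventually_ge_atTop 1] with n hn
  obtain ⟨m, rfl⟩ := Nat.exists_eq_add_of_le' hn
  obtain ⟨b, h1, h2⟩ := hpow m
  rw [h1, h2, WithLp.unitization_norm_inr, WithLp.unitization_norm_inr, hj]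

end SpectralRadius

theorem enorm_character_le_specRadius {A : Type*} [NonUnitalNormedCommRing A] [NormedSpace ℂ A]
    [IsScalarTower ℂ A A] [SMulCommClass ℂ A A] [CompleteSpace A]
    (χ : WeakDual.characterSpace ℂ (L1Unitization A)) (a : A) :
    ‖χ (toL1Unitization a)‖ₑ ≤ specRadius a := by
  rw [specRadius_eq_spectralRadius]
  exact le_iSup₂ (f := fun k (_ : k ∈ spectrum ℂ (toL1Unitization a)) => ‖k‖ₑ) _
    (WeakDual.CharacterSpace.mem_spectrum_iff_exists.2 ⟨χ, rfl⟩)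

/-! ### The algebra generated by a semigroup -/

section Generated

variable {B : Type*} [NonUnitalNormedRing B] [NormedSpace ℂ B] [IsScalarTower ℂ B B]
  [SMulCommClass ℂ B B] {α : ℝ} {T : ℂ → B}

theorem IsAnalyticSemigroup.mul_comm_of_mem (hT : IsAnalyticSemigroup α T) :
    ∀ x y : semigroupAlgebra α T, x * y = y * x := by
  have h : IsMulCommutative (NonUnitalAlgebra.adjoin ℂ (T '' sector α)) := by
    refine NonUnitalAlgebra.isMulCommutative_adjoin ℂ ?_
    rintro _ ⟨s, hs, rfl⟩ _ ⟨t, ht, rfl⟩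
    rw [← hT.map_add s hs t ht, ← hT.map_add t ht s hs, add_comm]
  exact (NonUnitalSubalgebra.nonUnitalCommRingTopologicalClosure _
    (fun x y => h.is_comm.comm x y)).mul_comm

/-- The algebra generated by an analytic semigroup is a commutative normed ring. -/
@[reducible]
noncomputable def IsAnalyticSemigroup.normedCommRing (hT : IsAnalyticSemigroup α T) :
    NonUnitalNormedCommRing (semigroupAlgebra α T) :=
  { (semigroupAlgebra α T).nonUnitalNormedRing with
    mul_comm := hT.mul_comm_of_mem }

noncomputable instance : NormedSpace ℂ (semigroupAlgebra α T) where
  norm_smul_le c x := norm_smul_le c (x : B)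

instance [CompleteSpace B] : CompleteSpace (semigroupAlgebra α T) :=
  (NonUnitalSubalgebra.isClosed_topologicalClosure _).completeSpace_coe

/-- The inclusion of the algebra generated by a semigroup. -/
noncomputable def semigroupAlgebraSubtypeL : semigroupAlgebra α T →L[ℂ] B :=
  LinearMap.mkContinuous
    { toFun := fun x => (x : B)
      map_add' := fun _ _ => rfl
      map_smul' := fun _ _ => rfl } 1 fun x => (one_mul ‖x‖).ge

open Classical in
/-- The semigroup as a map to the algebra it generates. -/
noncomputable def restrictSemigroup (α : ℝ) (T : ℂ → B) (t : ℂ) : semigroupAlgebra α T :=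
  if ht : t ∈ sector α then ⟨T t, mem_semigroupAlgebra T ht⟩ else 0

theorem restrictSemigroup_of_mem {t : ℂ} (ht : t ∈ sector α) :
    restrictSemigroup α T t = ⟨T t, mem_semigroupAlgebra T ht⟩ := dif_pos ht

theorem coe_restrictSemigroup {t : ℂ} (ht : t ∈ sector α) :
    (restrictSemigroup α T t : B) = T t := by rw [restrictSemigroup_of_mem ht]

theorem isAnalyticSemigroup_restrictSemigroup (hα₀ : 0 < α) (hα₁ : α < Real.pi / 2)
    (hT : IsAnalyticSemigroup α T) : IsAnalyticSemigroup α (restrictSemigroup α T) where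
  map_add s hs t ht := Subtype.ext <| by
    rw [NonUnitalSubalgebra.coe_mul, coe_restrictSemigroup hs, coe_restrictSemigroup ht,
      coe_restrictSemigroup (add_mem_sector hα₀ hα₁ hs ht), hT.map_add s hs t ht]
  differentiableOn t ht := by
    have hnhds := (isOpen_sector hα₀ hα₁).mem_nhds ht
    have hd : HasDerivAt (fun s => (restrictSemigroup α T s : B)) (deriv T t) t := by
      refine (hT.hasDerivAt hα₀ hα₁ ht).congr_of_eventuallyEq ?_
      filter_upwards [hnhds] with s hs using coe_restrictSemigroup hs
    have hslope := hasDerivAt_iff_tendsto_slope.1 hd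
    -- The derivative is a limit of difference quotients, which lie in a closed subalgebra.
    have hmem : deriv T t ∈ semigroupAlgebra α T := by
      refine (NonUnitalSubalgebra.isClosed_topologicalClosure _).mem_of_tendsto hslope
        (Eventually.of_forall fun s => ?_)
      exact ((s - t)⁻¹ • (restrictSemigroup α T s - restrictSemigroup α T t)).2
    have : HasDerivAt (restrictSemigroup α T) ⟨deriv T t, hmem⟩ t :=
      hasDerivAt_iff_tendsto_slope.2 (tendsto_subtype_rng.2 hslope)
    exact this.differentiableAt.differentiableWithinAt

theorem coe_funcCalc_restrictSemigroup [CompleteSpace B] {μ : ComplexMeasure (sector α)}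
    {K : Set (sector α)} (hK : IsCompact K)
    (hμ : ∀ E, MeasurableSet E → Disjoint E K → μ E = 0)
    (hα₀ : 0 < α) (hα₁ : α < Real.pi / 2) (hT : IsAnalyticSemigroup α T) {t : ℝ} (ht : 0 < t) :
    ((funcCalc μ (restrictSemigroup α T) t : semigroupAlgebra α T) : B) = funcCalc μ T t := by
  refine (map_cintegral semigroupAlgebraSubtypeL (integrable_of_compact_support hK hμ
    ((isAnalyticSemigroup_restrictSemigroup hα₀ hα₁ hT).continuous_ofReal_mul ht))).trans ?_
  exact congrArg (cintegral μ) (funext fun ξ =>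
    coe_restrictSemigroup (ofReal_mul_mem_sector ht ξ.2))

/-- The kernel of `f`, viewed in `B`, is a closed subalgebra containing the semigroup. Applied to
characters, this gives the hypothesis `hgen`. -/
theorem eq_zero_of_eq_zero_on_semigroup {F : Type*} [NonUnitalNormedRing F] [NormedSpace ℂ F]
    {f : semigroupAlgebra α T →L[ℂ] F} (hf : ∀ x y, f (x * y) = f x * f y)
    (h : ∀ t ∈ sector α, f (restrictSemigroup α T t) = 0) (x : semigroupAlgebra α T) : f x = 0 := by
  let N : NonUnitalSubalgebra ℂ B :=
    { carrier := Subtype.val '' {x : semigroupAlgebra α T | f x = 0}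
      add_mem' := by
        rintro _ _ ⟨x, hx, rfl⟩ ⟨y, hy, rfl⟩
        exact ⟨x + y, by simp_all, rfl⟩
      zero_mem' := ⟨0, map_zero f, rfl⟩
      mul_mem' := by
        rintro _ _ ⟨x, hx, rfl⟩ ⟨y, hy, rfl⟩
        exact ⟨x * y, (hf x y).trans (by rw [mem_ofPred.1 hx, zero_mul]), rfl⟩
      smul_mem' := by
        rintro c _ ⟨x, hx, rfl⟩
        exact ⟨c • x, by simp_all, rfl⟩ }
  have hN : IsClosed (N : Set B) :=
    (NonUnitalSubalgebra.isClosed_topologicalClosure _).isClosedEmbedding_subtypeVal.isClosedMap _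
      (isClosed_eq f.continuous continuous_const)
  have hle : semigroupAlgebra α T ≤ N := by
    refine NonUnitalSubalgebra.topologicalClosure_minimal (NonUnitalAlgebra.adjoin_le ?_) hN
    rintro _ ⟨t, ht, rfl⟩
    exact ⟨restrictSemigroup α T t, h t ht, coe_restrictSemigroup ht⟩
  obtain ⟨y, hy, hyx⟩ := hle x.2
  rw [← Subtype.ext hyx]
  exact hy

theorem exists_bounded_generator [CompleteSpace B] (hα₀ : 0 < α) (hα₁ : α < Real.pi / 2)
    {μ : ComplexMeasure (sector α)} (hsupp : HasCompactSupp μ) (hμ₀ : μ univ = 0)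
    (hreal : ∀ x : ℝ, 0 < x → (laplace μ x).im = 0) (hT : IsAnalyticSemigroup α T)
    {t₀ : ℝ} (ht₀ : 0 < t₀)
    (hlt : ∀ t : ℝ, 0 < t → t ≤ t₀ → specRadius (funcCalc μ T t) < supOnPos (laplace μ)) :
    ∃ e : ModRad (semigroupAlgebra α T), IsIdentity e ∧ ∃ u, IsBoundedGenerator T e u := by
  let : NonUnitalNormedCommRing (semigroupAlgebra α T) := hT.normedCommRing
  obtain ⟨K, hK, hμ⟩ := hsupp
  obtain ⟨e, he, u, hu⟩ := exists_bounded_generator_of_enorm_character_lt hα₀ hα₁ ⟨K, hK, hμ⟩ hμ₀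
    hreal (isAnalyticSemigroup_restrictSemigroup hα₀ hα₁ hT)
    (fun χ h => eq_zero_of_eq_zero_on_semigroup
      (f := (WeakDual.toStrongDual (χ : WeakDual ℂ (L1Unitization (semigroupAlgebra α T)))).comp
        toL1Unitization) (fun x y => by
          change χ (toL1Unitization (x * y)) = _
          rw [toL1Unitization_mul, map_mul]; rfl) h) ht₀
    (fun χ t ht htt => by
      refine (enorm_character_le_specRadius χ _).trans_lt ?_
      have h1 := hlt t ht htt
      rw [← coe_funcCalc_restrictSemigroup hK hμ hα₀ hα₁ hT ht] at h1
      refine lt_of_eq_of_lt ?_ h1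
      exact (specRadius_eq_of_norm_eq (NonUnitalSubalgebraClass.subtype (semigroupAlgebra α T))
        (fun _ => rfl) _).symm)
  refine ⟨e, he, u, fun t => ?_⟩
  have := hu t t.2
  rw [restrictSemigroup_of_mem t.2] at this
  exact this

end Generated

/-! ### Multiplicative functionals on a nonunital algebra -/

section Characters

variable {A : Type*} [NonUnitalNormedRing A] [NormedSpace ℂ A] [IsScalarTower ℂ A A]
  [SMulCommClass ℂ A A]

theorem enorm_apply_le_specRadius (f : A →ₙₐ[ℂ] ℂ) (a : A) : ‖f a‖ₑ ≤ specRadius a := by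
  have h := AlgHom.apply_mem_spectrum (Unitization.lift f) (a : Unitization ℂ A)
  have hf : Unitization.lift f (a : Unitization ℂ A) = f a := by simp
  rw [hf, ← Unitization.quasispectrum_eq_spectrum_inr] at h
  exact le_iSup₂ (f := fun k (_ : k ∈ quasispectrum ℂ a) => ‖k‖ₑ) _ h

/-- The extension to the unitization is a surjection onto `ℂ`; it maps the Jacobson radical into
that of a field, which is zero. -/
theorem apply_eq_zero_of_mem_radical (f : A →ₙₐ[ℂ] ℂ) {a : A} (ha : a ∈ radical A) : f a = 0 := by
  set g : Unitization ℂ A →+* ℂ := ((Unitization.lift f : Unitization ℂ A →ₐ[ℂ] ℂ) : Unitization ℂ A →+* ℂ)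
  have hg : Function.Surjective g := fun c => ⟨algebraMap ℂ _ c, by
    simp [g]⟩
  have : RingHomSurjective g := ⟨hg⟩
  have h : g (a : Unitization ℂ A) ∈ Ring.jacobson ℂ := Ring.le_comap_jacobson g ha
  rw [Ring.jacobson_eq_sInf_isMaximal, Ideal.mem_sInf] at h
  simpa [g] using h (I := ⊥) Ideal.bot_isMaximal

end Characters

/-! ### Sharpness: the semigroup of powers -/

section PowSemigroup

open unitInterval

/-- Evaluation at a point, as a multiplicative functional. -/
noncomputable def evalHom (x : I) : ContinuousMapZero I ℂ →ₙₐ[ℂ] ℂ where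
  toFun g := g x
  map_add' _ _ := rfl
  map_mul' _ _ := rfl
  map_zero' := rfl
  map_smul' _ _ := rfl

theorem norm_le_of_forall_norm_apply_le {g : ContinuousMapZero I ℂ} {C : ℝ} (hC : 0 ≤ C)
    (h : ∀ x, ‖g x‖ ≤ C) : ‖g‖ ≤ C :=
  ((g : C(I, ℂ)).norm_le hC).2 h

/-- Continuity at `0` forbids it. This is the common obstruction to a unit and to a limit at `0⁺`.
-/
theorem not_forall_apply_eq_one (g : ContinuousMapZero I ℂ) : ¬ ∀ x : I, 0 < (x : ℝ) → g x = 1 := by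
  intro h
  have ht : Tendsto (fun n : ℕ => (⟨1 / ((n : ℝ) + 1), by
      constructor
      · positivity
      · rw [div_le_one (by positivity)]; linarith [n.cast_nonneg (α := ℝ)]⟩ : I)) atTop (𝓝 0) :=
    tendsto_subtype_rng.2 tendsto_one_div_add_atTop_nhds_zero_nat
  have h1 := ((map_continuous g).tendsto 0).comp ht
  rw [map_zero] at h1
  have h2 : Tendsto (fun _ : ℕ => (1 : ℂ)) atTop (𝓝 0) :=
    h1.congr fun n => h _ (by simp only [one_div]; positivity)
  exact one_ne_zero (tendsto_nhds_unique tendsto_const_nhds h2)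

theorem powSemigroup_apply {t : ℂ} (ht : 0 < t.re) (x : I) :
    powSemigroup t x = ((x : ℝ) : ℂ) ^ t := by
  rw [powSemigroup, dif_pos ht]; rfl

theorem powSemigroup_apply_of_pos {t : ℂ} (ht : 0 < t.re) {x : I} (hx : 0 < (x : ℝ)) :
    powSemigroup t x = Complex.exp (Real.log x * t) := by
  rw [powSemigroup_apply ht, Complex.cpow_def_of_ne_zero (by exact_mod_cast hx.ne'),
    Complex.ofReal_log hx.le]

/-- Half of the power absorbs the logarithm; the other half gives continuity of the derivative at `x
= 0`. -/
theorem norm_cpow_mul_log_le {t : ℂ} (ht : 0 < t.re) {x : ℝ} (hx₀ : 0 ≤ x) (hx₁ : x ≤ 1) :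
    ‖(x : ℂ) ^ t * Real.log x‖ ≤ 2 / t.re * x ^ (t.re / 2) := by
  rcases hx₀.eq_or_lt with rfl | hx
  · simp; positivity
  · have h := (Real.abs_log_mul_self_rpow_lt x (t.re / 2) hx hx₁ (by positivity)).le
    rw [abs_mul, abs_of_pos (Real.rpow_pos_of_pos hx _)] at h
    rw [norm_mul, Complex.norm_cpow_eq_rpow_re_of_pos hx, Complex.norm_real, Real.norm_eq_abs]
    calc x ^ t.re * |Real.log x| = |Real.log x| * x ^ (t.re / 2) * x ^ (t.re / 2) := by
          rw [mul_assoc, ← Real.rpow_add hx, add_halves, mul_comm]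
      _ ≤ 1 / (t.re / 2) * x ^ (t.re / 2) := by gcongr
      _ = _ := by field_simp

/-- The derivative `x ↦ x ^ t log x` of the semigroup of powers. -/
noncomputable def powLog (t : ℂ) (ht : 0 < t.re) : ContinuousMapZero I ℂ where
  toFun x := ((x : ℝ) : ℂ) ^ t * Real.log x
  continuous_toFun := continuous_iff_continuousAt.2 fun x => by
    rcases x.2.1.eq_or_lt with hx | hx
    · have hx0 : x = 0 := Subtype.ext hx.symm
      subst hx0
      have h : Tendsto (fun y : I => 2 / t.re * (y : ℝ) ^ (t.re / 2)) (𝓝 0) (𝓝 0) := by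
        have := ((Real.continuousAt_rpow_const ((0 : I) : ℝ) (t.re / 2) (Or.inr (by positivity))).comp
          continuous_subtype_val.continuousAt).const_mul (2 / t.re)
        convert! this.tendsto using 2
        simp [Real.zero_rpow (by positivity : t.re / 2 ≠ 0)]
      refine (squeeze_zero_norm (fun y : I => norm_cpow_mul_log_le ht y.2.1 y.2.2) h).trans ?_
      simp
    · refine ((Complex.continuousAt_ofReal_cpow_const (x : ℝ) t (Or.inl ht)).comp
          continuous_subtype_val.continuousAt).mul ?_
      exact (Complex.continuous_ofReal.continuousAt.comp (Real.continuousAt_log hx.ne')).comp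
        continuous_subtype_val.continuousAt
  map_zero' := by simp

theorem hasDerivAt_powSemigroup {t : ℂ} (ht : 0 < t.re) :
    HasDerivAt powSemigroup (powLog t ht) t := by
  refine hasDerivAt_of_norm_sub_le_sq (δ := t.re / 2) (C := 8 / t.re ^ 2) (by positivity)
    fun w hw => norm_le_of_forall_norm_apply_le (by positivity) fun x => ?_
  have htw : 0 < (t + w).re := by
    have := (abs_le.1 (Complex.abs_re_le_norm w)).1
    rw [Complex.add_re]; linarith
  change ‖powSemigroup (t + w) x - powSemigroup t x - w * (((x : ℝ) : ℂ) ^ t * Real.log x)‖ ≤ _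
  rcases x.2.1.eq_or_lt with hx | hx
  · have hx0 : x = 0 := Subtype.ext hx.symm
    subst hx0
    simp only [map_zero]
    simp; positivity
  · rw [← powSemigroup_apply ht, powSemigroup_apply_of_pos htw hx, powSemigroup_apply_of_pos ht hx]
    set l := Real.log x
    have hl : l ≤ 0 := Real.log_nonpos x.2.1 x.2.2
    have h1 : Complex.exp (l * (t + w)) - Complex.exp (l * t) - w * (Complex.exp (l * t) * l) =
        Complex.exp (l * t) * (Complex.exp (l * w) - ∑ m ∈ Finset.range 2, (l * w) ^ m / m.factorial) := by
      rw [mul_add, Complex.exp_add]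
      simp [Finset.sum_range_succ]
      ring
    rw [h1, norm_mul, Complex.norm_exp, Complex.re_ofReal_mul]
    have h2 := Complex.norm_exp_sub_sum_le_norm_mul_exp (l * w) 2
    have h3 : ‖(l : ℂ) * w‖ = -l * ‖w‖ := by
      rw [norm_mul, Complex.norm_real, Real.norm_of_nonpos hl]
    rw [h3] at h2
    -- One factor `exp(-l Re t / 2)` absorbs `l²`, and a second one bounds `exp(|l| ‖w‖)`. Together
    -- they cancel `exp(l Re t)`, so the estimate is uniform in `x`, with constant `8 / (Re t)²`.
    have h4 : (-l * (t.re / 2)) ^ 2 / 2 ≤ Real.exp (-l * (t.re / 2)) := by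
      have h0 : 0 ≤ -l * (t.re / 2) := mul_nonneg (by linarith) (by positivity)
      have := Real.quadratic_le_exp_of_nonneg h0
      linarith
    calc Real.exp (l * t.re) * _ ≤ Real.exp (l * t.re) *
          ((-l * ‖w‖) ^ 2 * Real.exp (-l * (t.re / 2))) := by
          gcongr
          refine h2.trans ?_
          gcongr
          linarith
      _ = (-l * (t.re / 2)) ^ 2 / 2 * (8 / t.re ^ 2 * ‖w‖ ^ 2) *
            (Real.exp (l * t.re) * Real.exp (-l * (t.re / 2))) := by
          field_simp; ring
      _ ≤ Real.exp (-l * (t.re / 2)) * (8 / t.re ^ 2 * ‖w‖ ^ 2) *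
            (Real.exp (l * t.re) * Real.exp (-l * (t.re / 2))) := by gcongr
      _ = 8 / t.re ^ 2 * ‖w‖ ^ 2 * (Real.exp (-l * (t.re / 2)) * (Real.exp (l * t.re) *
            Real.exp (-l * (t.re / 2)))) := by ring
      _ = 8 / t.re ^ 2 * ‖w‖ ^ 2 := by
          rw [← Real.exp_add, ← Real.exp_add]
          ring_nf
          simp

variable {α : ℝ}

theorem isAnalyticSemigroup_powSemigroup : IsAnalyticSemigroup α powSemigroup where
  differentiableOn t ht := (hasDerivAt_powSemigroup ht.1).differentiableAt.differentiableWithinAt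
  map_add s hs t ht := by
    ext x
    have hst : 0 < (s + t).re := add_pos hs.1 ht.1
    change powSemigroup (s + t) x = powSemigroup s x * powSemigroup t x
    rcases x.2.1.eq_or_lt with hx | hx
    · have hx0 : x = 0 := Subtype.ext hx.symm
      simp [hx0]
    · rw [powSemigroup_apply_of_pos hst hx, powSemigroup_apply_of_pos hs.1 hx,
        powSemigroup_apply_of_pos ht.1 hx, mul_add, Complex.exp_add]

theorem not_isQuasinilpotent_powSemigroup (hα₀ : 0 < α) : ¬ IsQuasinilpotent α powSemigroup := by
  intro h
  have h1 : (1 : ℂ) ∈ sector α := by simpa using ofReal_mem_sector hα₀ one_pos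
  have h2 := enorm_apply_le_specRadius (evalHom 1) (powSemigroup 1)
  rw [h 1 h1] at h2
  have h3 : evalHom 1 (powSemigroup 1) = 1 := by
    change powSemigroup 1 1 = 1
    rw [powSemigroup_apply (by simp)]
    simp
  rw [h3] at h2
  simp at h2

theorem funcCalc_powSemigroup_apply {μ : ComplexMeasure (sector α)} {K : Set (sector α)}
    (hK : IsCompact K) (hμ : ∀ E, MeasurableSet E → Disjoint E K → μ E = 0) {t : ℝ} (ht : 0 < t)
    {x : I} (hx : 0 < (x : ℝ)) :
    funcCalc μ powSemigroup t x = laplace μ ((-(t * Real.log x) : ℝ) : ℂ) := by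
  refine (map_cintegral (ContinuousMapZero.evalCLM ℂ x) (integrable_of_compact_support hK hμ
    (isAnalyticSemigroup_powSemigroup.continuous_ofReal_mul ht))).trans ?_
  refine congrArg (cintegral μ) (funext fun ξ => ?_)
  refine (powSemigroup_apply_of_pos (ofReal_mul_mem_sector ht ξ.2).1 hx).trans ?_
  congr 1
  push_cast
  ring

theorem specRadius_funcCalc_powSemigroup {μ : ComplexMeasure (sector α)}
    (hsupp : HasCompactSupp μ) (hμ₀ : μ univ = 0) {t : ℝ} (ht : 0 < t) :
    specRadius (funcCalc μ powSemigroup t) = supOnPos (laplace μ) := by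
  obtain ⟨K, hK, hμ⟩ := hsupp
  have htop := supOnPos_laplace_ne_top hK hμ
  refine le_antisymm ((specRadius_le_enorm _).trans ?_) (iSup₂_le fun y hy => ?_)
  · rw [← ENNReal.ofReal_toReal htop, ← ofReal_norm]
    refine ENNReal.ofReal_le_ofReal (norm_le_of_forall_norm_apply_le ENNReal.toReal_nonneg
      fun x => ?_)
    rcases x.2.1.eq_or_lt with hx | hx
    · have hx0 : x = 0 := Subtype.ext hx.symm
      rw [hx0, map_zero, norm_zero]
      exact ENNReal.toReal_nonneg
    rw [funcCalc_powSemigroup_apply hK hμ ht hx]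
    rcases x.2.2.eq_or_lt with hx1 | hx1
    -- At `x = 1` the argument is `0`, outside the range of the supremum; there the zero total mass
    -- of `μ` is used.
    · rw [hx1, Real.log_one, mul_zero, neg_zero, Complex.ofReal_zero, laplace_zero hμ₀, norm_zero]
      exact ENNReal.toReal_nonneg
    · have hy : 0 < -(t * Real.log x) := by
        have := mul_pos ht (neg_pos.2 (Real.log_neg hx hx1))
        linarith
      rw [← toReal_enorm]
      exact ENNReal.toReal_mono htop
        (le_iSup₂ (f := fun (y : ℝ) (_ : 0 < y) => ‖laplace μ y‖ₑ) _ hy)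
  -- The point where `-t log x = y`.
  · set x : I := ⟨Real.exp (-(y / t)), (Real.exp_pos _).le,
      Real.exp_le_one_iff.2 (neg_nonpos.2 (by positivity))⟩
    have hx : 0 < (x : ℝ) := Real.exp_pos _
    have h := enorm_apply_le_specRadius (evalHom x) (funcCalc μ powSemigroup t)
    have h1 : evalHom x (funcCalc μ powSemigroup t) = laplace μ y := by
      refine (funcCalc_powSemigroup_apply hK hμ ht hx).trans ?_
      rw [show Real.log x = -(y / t) from Real.log_exp _]
      congr 2
      field_simp
    rwa [h1] at h

theorem not_exists_isIdentity_powSemigroup (hα₀ : 0 < α) :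
    ¬ ∃ e : ModRad (semigroupAlgebra α powSemigroup), IsIdentity e := by
  rintro ⟨e, he⟩
  obtain ⟨p, rfl⟩ := (radical (semigroupAlgebra α powSemigroup)).mkQ_surjective e
  have h1 : (1 : ℂ) ∈ sector α := by simpa using ofReal_mem_sector hα₀ one_pos
  set a : semigroupAlgebra α powSemigroup := ⟨powSemigroup 1, mem_semigroupAlgebra _ h1⟩
  have hrad : p * a - a ∈ radical (semigroupAlgebra α powSemigroup) :=
    (Submodule.Quotient.eq _).1 (he (toModRad _ a)).1
  -- Evaluations kill the radical, so `p(x) x = x` at every point, and `p` would equal `1` on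
  -- `(0,1]`.
  refine not_forall_apply_eq_one (p : ContinuousMapZero I ℂ) fun x hx => ?_
  have h2 := apply_eq_zero_of_mem_radical ((evalHom x).comp
    (NonUnitalSubalgebraClass.subtype (semigroupAlgebra α powSemigroup))) hrad
  have h3 : (p : ContinuousMapZero I ℂ) x * powSemigroup 1 x - powSemigroup 1 x = 0 := h2
  have h4 : powSemigroup 1 x ≠ 0 := by
    rw [powSemigroup_apply_of_pos (by simp) hx]
    exact Complex.exp_ne_zero _
  have h5 : ((p : ContinuousMapZero I ℂ) x - 1) * powSemigroup 1 x = 0 := by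
    rw [sub_mul, one_mul, h3]
  exact sub_eq_zero.1 ((mul_eq_zero.1 h5).resolve_right h4)

theorem not_exists_tendsto_powSemigroup :
    ¬ ∃ L, Tendsto (fun t : ℝ => powSemigroup t) (𝓝[>] 0) (𝓝 L) := by
  rintro ⟨L, hL⟩
  refine not_forall_apply_eq_one L fun x hx => ?_
  have h1 : Tendsto (fun t : ℝ => powSemigroup t x) (𝓝[>] 0) (𝓝 (L x)) :=
    ((ContinuousMapZero.evalCLM ℂ x).continuous.tendsto L).comp hL
  have h2 : Tendsto (fun t : ℝ => Complex.exp (Real.log x * t)) (𝓝[>] 0) (𝓝 1) := by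
    have : Continuous fun t : ℝ => Complex.exp (Real.log x * t) := by fun_prop
    exact (this.tendsto' 0 1 (by simp)).mono_left nhdsWithin_le_nhds
  refine tendsto_nhds_unique h1 (h2.congr' ?_)
  filter_upwards [self_mem_nhdsWithin] with t ht
  exact (powSemigroup_apply_of_pos (by simpa using ht) hx).symm

end PowSemigroup

end SectorSemigroup

open SectorSemigroup in
theorem theorem3p5 (α : ℝ) (hα₀ : 0 < α) (hα₁ : α < Real.pi / 2)
    (φ : holSpace α →L[ℂ] ℂ) (μ : ComplexMeasure (sector α))
    (hφμ : IsInducedBy φ μ) (hsupp : HasCompactSupp μ) (hsymm : IsSymmetric μ)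
    (hμ : μ Set.univ = 0)
    (hreal : ∀ x : ℝ, 0 < x → (fourierBorel φ x).im = 0) :
    (∀ (B : Type*) [NonUnitalNormedRing B] [NormedSpace ℂ B] [IsScalarTower ℂ B B]
        [SMulCommClass ℂ B B] [CompleteSpace B] (T : ℂ → B),
        IsAnalyticSemigroup α T → ¬ IsQuasinilpotent α T →
        (∃ t₀ : ℝ, 0 < t₀ ∧ ∀ t : ℝ, 0 < t → t ≤ t₀ →
          specRadius (funcCalc μ T t) < supOnPos (fourierBorel φ)) →
        ∃ e : ModRad (semigroupAlgebra α T), IsIdentity e ∧ ∃ u, IsBoundedGenerator T e u) ∧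
    (IsAnalyticSemigroup α powSemigroup ∧ ¬ IsQuasinilpotent α powSemigroup ∧
      (∀ t : ℝ, 0 < t →
        specRadius (funcCalc μ powSemigroup t) = supOnPos (fourierBorel φ)) ∧
      (¬ ∃ e : ModRad (semigroupAlgebra α powSemigroup), IsIdentity e) ∧
      ¬ ∃ L, Tendsto (fun t : ℝ => powSemigroup t) (𝓝[>] 0) (𝓝 L)) := by
  rw [fourierBorel_eq_laplace hφμ] at *
  exact ⟨fun B _ _ _ _ _ T hT _ ⟨_, ht₀, hlt⟩ =>
      exists_bounded_generator hα₀ hα₁ hsupp hμ hreal hT ht₀ hlt,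
    isAnalyticSemigroup_powSemigroup, not_isQuasinilpotent_powSemigroup hα₀,
    fun _ ht => specRadius_funcCalc_powSemigroup hsupp hμ ht,
    not_exists_isIdentity_powSemigroup hα₀, not_exists_tendsto_powSemigroup⟩
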